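/- Let $\mathcal A$ be a finite alphabet, $\mu$ a probability measure on $\mathcal A$ with $\mu(a)>0$ for all $a$, and let $x_1,x_2,\dots,y_1,y_2,\dots$ be independent random letters with law $\mu$. Let $K:\mathcal A\times\mathcal A\to\mathbb R$ be symmetric with $E[K(x_1,y_1)]<0$ and $\max_{a,b}K(a,b)>0$, and let $\theta_*$ be the unique positive root of $E\exp[\theta K(x_1,y_1)]=1$. For a gap penalty $g:\{0,1,\dots\}\to[0,\infty)$ with $g(0)=0$, words $\mathbf x_m=x_1\cdots x_m$, $\mathbf y_n=y_1\cdots y_n$ and an alignment $\mathbf z=\{(i(t),j(t)):1\le t\le u\}$, $u\ge 1$, $1\le i(1)<\dots<i(u)\le m$, $1\le j(1)<\dots<j(u)\le n$, put $$S_{\mathbf z}(\mathbf x_m,\mathbf y_n)=\sum_{t=1}^{u}K(x_{i(t)},y_{j(t)})-\sum_{t=1}^{u-1}\bigl[g(i(t+1)-i(t)-1)+g(j(t+1)-j(t)-1)\bigr],$$ $$R_{\mathbf z}(\mathbf x_m,\mathbf y_n)=S_{\mathbf z}(\mathbf x_m,\mathbf y_n)-g(i(1)-1)-g(j(1)-1)-g(m-i(u))-g(n-j(u)).$$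 Let $H(\mathbf x_m,\mathbf y_n)=\max_{\mathbf z}S_{\mathbf z}(\mathbf x_m,\mathbf y_n)$ (local alignment score) and $G(\mathbf x_m,\mathbf y_n)=\max_{\mathbf z}R_{\mathbf z}(\mathbf x_m,\mathbf y_n)$ (global alignment score). Say that $g$ lies in the *logarithmic domain* if there are $0<\tau_1<\tau_2$ with $\lim_{n\to\infty}P\{\tau_1<H(\mathbf x_n,\mathbf y_n)/\log n<\tau_2\}=1$, and in the *linear domain* if $\beta=\lim_{n\to\infty}E[G(\mathbf x_n,\mathbf y_n)/n]$ exists and is positive and $H(\mathbf x_n,\mathbf y_n)/n\to\beta$ in probability. **Theorem 1.** Let $g(0)=0$ and $g(k)=\Delta+\gamma(k)$ for $k\ge1$, where $\Delta\ge0$, $\gamma(1)=0$ and $\gamma$ is nondecreasing and concave on $\{1,2,\dots\}$. (a) If $\sum_{k=1}^\infty \exp[-\hat\theta\gamma(k)]<\infty$ for some $\hat\theta<\theta_*$, then $g$ lies in the logarithmic domain for all sufficiently large $\Delta$. (b) If $\sum_{k=1}^\infty \exp[-\hat\theta\gamma(k)]=\infty$ for some $\hat\theta>\theta_*$, then $g$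 lies in the linear domain for all $\Delta\ge0$. (c) Let $\gamma(k)=\delta\log k$ for some $\delta>0$. If $\delta>1/\theta_*$, then $g$ lies in the logarithmic domain for all sufficiently large $\Delta$; if $\delta<1/\theta_*$, then $g$ lies in the linear domain for all $\Delta\ge0$. -/

import Mathlib

open MeasureTheory ProbabilityTheory Filter Topology

/-- A nonempty candidate alignment of a word of length `m` with a word of length `n`: `u + 1`
matched pairs `(i 0, j 0), …, (i u, j u)` of positions, strictly increasing in both coordinates.
Positions are counted from `0`. -/
structure CandidateAlignment (m n : ℕ) where
  /-- The number of matched pairs minus one. -/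
  u : ℕ
  /-- The matched positions in the first word. -/
  i : Fin (u + 1) → Fin m
  /-- The matched positions in the second word. -/
  j : Fin (u + 1) → Fin n
  i_strictMono : StrictMono i
  j_strictMono : StrictMono j

namespace CandidateAlignment

variable {A : Type*} {m n : ℕ}

/-- The score `S_z`: the sum of the similarities of the matched letters, minus the penalties
of the gaps between consecutive matches, in both words. -/
noncomputable def localValue (z : CandidateAlignment m n) (K : A → A → ℝ) (g : ℕ → ℝ)
    (x : Fin m → A) (y : Fin n → A) : ℝ :=
  (∑ t : Fin (z.u + 1), K (x (z.i t)) (y (z.j t)))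
    - ∑ t : Fin z.u,
        (g ((z.i t.succ : ℕ) - (z.i t.castSucc : ℕ) - 1)
          + g ((z.j t.succ : ℕ) - (z.j t.castSucc : ℕ) - 1))

/-- The score `R_z`: as `S_z`, but the unaligned letters before the first match and after the
last match are penalized as well. -/
noncomputable def globalValue (z : CandidateAlignment m n) (K : A → A → ℝ) (g : ℕ → ℝ)
    (x : Fin m → A) (y : Fin n → A) : ℝ :=
  z.localValue K g x y
    - g (z.i 0 : ℕ) - g (z.j 0 : ℕ)
    - g (m - 1 - (z.i (Fin.last z.u) : ℕ)) - g (n - 1 - (z.j (Fin.last z.u) : ℕ))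

end CandidateAlignment

/-- The local alignment score `H(x, y)`. For nonempty words this is a maximum over a nonempty
finite set of alignments. -/
noncomputable def localScore {A : Type*} {m n : ℕ} (K : A → A → ℝ) (g : ℕ → ℝ)
    (x : Fin m → A) (y : Fin n → A) : ℝ :=
  ⨆ z : CandidateAlignment m n, z.localValue K g x y

/-- The global alignment score `G(x, y)`. -/
noncomputable def globalScore {A : Type*} {m n : ℕ} (K : A → A → ℝ) (g : ℕ → ℝ)
    (x : Fin m → A) (y : Fin n → A) : ℝ :=
  ⨆ z : CandidateAlignment m n, z.globalValue K g x y

/-- The prefix of length `n` of a random sequence of letters. -/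
def randomWord {Ω A : Type*} (X : ℕ → Ω → A) (n : ℕ) (ω : Ω) : Fin n → A :=
  fun i => X i ω

/-- The gap penalty `g` with `g 0 = 0` and `g k = Δ + γ k` for `k ≥ 1`. -/
noncomputable def gapPenalty (Δ : ℝ) (γ : ℕ → ℝ) (k : ℕ) : ℝ :=
  if k = 0 then 0 else Δ + γ k

/-- The length-dependent part `γ` of a gap penalty: it vanishes at `1` and is nondecreasing and
concave on `{1, 2, …}`. The value `γ 0` plays no role. -/
structure IsGapExtension (γ : ℕ → ℝ) : Prop where
  one : γ 1 = 0
  mono : ∀ k, 1 ≤ k → γ k ≤ γ (k + 1)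
  concave : ∀ k, 1 ≤ k → γ (k + 2) - γ (k + 1) ≤ γ (k + 1) - γ k

/-- `g` lies in the logarithmic domain: for some `0 < τ₁ < τ₂`, the probability that
`τ₁ < H(x_n, y_n) / log n < τ₂` tends to `1`. -/
def InLogarithmicDomain {Ω A : Type*} [MeasurableSpace Ω] (P : Measure Ω)
    (X Y : ℕ → Ω → A) (K : A → A → ℝ) (g : ℕ → ℝ) : Prop :=
  ∃ τ₁ τ₂ : ℝ, 0 < τ₁ ∧ τ₁ < τ₂ ∧
    Tendsto
      (fun n : ℕ => P {ω |
        τ₁ < localScore K g (randomWord X n ω) (randomWord Y n ω) / Real.log n ∧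
        localScore K g (randomWord X n ω) (randomWord Y n ω) / Real.log n < τ₂})
      atTop (𝓝 1)

/-- `g` lies in the linear domain: the limit `β` of `E[G(x_n, y_n) / n]` exists and is positive,
and `H(x_n, y_n) / n` converges to `β` in probability. -/
def InLinearDomain {Ω A : Type*} [MeasurableSpace Ω] (P : Measure Ω)
    (X Y : ℕ → Ω → A) (K : A → A → ℝ) (g : ℕ → ℝ) : Prop :=
  ∃ β : ℝ, 0 < β ∧
    Tendsto
      (fun n : ℕ => ∫ ω, globalScore K g (randomWord X n ω) (randomWord Y n ω) / n ∂P)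
      atTop (𝓝 β) ∧
    TendstoInMeasure P
      (fun (n : ℕ) ω => localScore K g (randomWord X n ω) (randomWord Y n ω) / n)
      atTop (fun _ => β)

/-!
Write `φ(s) = E exp (s K(x₁, y₁))`, so that `φ(θ) = 1`, and `H n`, `G n` for the local and global
scores of the words of length `n`.

**Logarithmic domain.** Along a fixed alignment with `u` matches the matched pairs are independent,
so `E exp (θ' S_z)` equals `φ(θ')^u` times the product of `exp (-θ' g)` over the gaps. An alignment
is determined by its first match and its gaps. Summing the Chernoff bounds over all alignments
therefore gives `n²` times a geometric series with ratio `φ(θ') (∑ k, exp (-θ' g k))²`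
(`measureReal_lt_localScore_le`). Strict convexity gives `φ(θ') < 1` for `0 < θ' < θ`
(`expMoment_lt_one`), and the sum over `k` tends to `1` as `Δ → ∞`; hence
`H n ≤ (3 / θ') log n` with high probability.

**A lower bound valid in both domains.** For every `s < 2 / θ`, already the ungapped local score
exceeds `s log n` with high probability (`tendsto_measureReal_localScore_lt_mul_log`). The words are
cut into blocks of length `ℓ ≈ ρ log n`, and the pairs of blocks are counted whose score and
marginal likelihood ratios are typical for the law `α(a, b) = μ(a) μ(b) exp (θ K(a, b))` of a matched
pair. A change of measure and the law of large numbers under `α` give the expected number of such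
pairs. For the second moment (`measureReal_forall_not_rel_le`) only pairs of pairs that share a
block matter. They are harmless because a fixed block has few typical partners: by the symmetry
of `K` the two marginals of `α` agree, and superadditivity of relative entropy bounds twice the
entropy of the marginal by that of `α` (`two_mul_marginalEntropy_le`).

**Linear domain.** Divergence of `∑ exp (-θ' γ)` makes `γ k ≤ log k / θ₁` infinitely often, for
`θ < θ₁ < θ'`; with concavity this makes `g` sublinear (`tendsto_gapPenalty_div`). Alignments of
consecutive windows of length `N` can be glued at a cost of `2 g(2N)` per joint
(`sum_localScore_windows_le`), so by the strong law `liminf H n / n` is almost surely at least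
`c N = (E H N - 2 g(2N)) / N`. Since `E H n / n = c n + o(1)`, both `E H n / n` and `H n / n`
converge to `β = sup c`. Moreover `|G n - H n| ≤ 4 g(n) = o(n)`, so `G` has the same limit. Finally
`β > 0`: for suitable `N` the mean of `H N` is close to `(2 / θ) log N`, while `2 g(2N)` is at most
`(2 / θ₁) log N` plus a constant (`exists_window_gap_lt_mean`).
-/

/-! ### Alignments as integer sequences -/

/-- The local score of the alignment that matches position `I t` of `x` with position `J t` of `y`
for `t ≤ u`, where the words are infinite and the positions are natural numbers. Gluing alignments
is easier here than with `Fin`-valued positions. -/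
noncomputable def seqScore {A : Type*} (K : A → A → ℝ) (g : ℕ → ℝ) (x y : ℕ → A)
    (u : ℕ) (I J : ℕ → ℕ) : ℝ :=
  (∑ t ∈ Finset.range (u + 1), K (x (I t)) (y (J t)))
    - ∑ t ∈ Finset.range u, (g (I (t + 1) - I t - 1) + g (J (t + 1) - J t - 1))

namespace CandidateAlignment

variable {A : Type*} {m n : ℕ}

lemma exists_of_seq {u : ℕ} {I J : ℕ → ℕ} (hI : ∀ t < u, I t < I (t + 1))
    (hJ : ∀ t < u, J t < J (t + 1)) (hm : I u < m) (hn : J u < n) :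
    ∃ z : CandidateAlignment m n, ∀ (K : A → A → ℝ) (g : ℕ → ℝ) (x y : ℕ → A),
      z.localValue K g (fun s => x s) (fun s => y s) = seqScore K g x y u I J := by
  have mono : ∀ I : ℕ → ℕ, (∀ t < u, I t < I (t + 1)) →
      StrictMono (fun t : Fin (u + 1) => I t) := fun I hI =>
    Fin.strictMono_iff_lt_succ.2 fun t => by simpa using hI t t.2
  have lt : ∀ (I : ℕ → ℕ) (m : ℕ), (∀ t < u, I t < I (t + 1)) → I u < m →
      ∀ t : Fin (u + 1), I t < m := fun I m hI hm t =>
    lt_of_le_of_lt (by simpa using (mono I hI).monotone (Fin.le_last t)) hm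
  refine ⟨⟨u, fun t => ⟨I t, lt I m hI hm t⟩, fun t => ⟨J t, lt J n hJ hn t⟩,
    fun _ _ h => mono I hI h, fun _ _ h => mono J hJ h⟩, fun K g x y => ?_⟩
  simp only [localValue, seqScore, Fin.val_succ, Fin.val_castSucc]
  rw [Fin.sum_univ_eq_sum_range (fun t => K (x (I t)) (y (J t))),
    Fin.sum_univ_eq_sum_range (fun t => g (I (t + 1) - I t - 1) + g (J (t + 1) - J t - 1))]

lemma exists_seq (z : CandidateAlignment m n) :
    ∃ (u : ℕ) (I J : ℕ → ℕ), (∀ t < u, I t < I (t + 1)) ∧ (∀ t < u, J t < J (t + 1)) ∧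
      I u < m ∧ J u < n ∧ ∀ (K : A → A → ℝ) (g : ℕ → ℝ) (x y : ℕ → A),
      z.localValue K g (fun s => x s) (fun s => y s) = seqScore K g x y u I J := by
  have ext : ∀ {k : ℕ} (f : Fin (z.u + 1) → Fin k), StrictMono f →
      ∃ F : ℕ → ℕ, (∀ t < z.u, F t < F (t + 1)) ∧ F z.u < k ∧
        ∀ t : Fin (z.u + 1), (f t : ℕ) = F t := by
    intro k f hf
    refine ⟨fun t => if h : t < z.u + 1 then f ⟨t, h⟩ else 0, fun t ht => ?_, ?_, fun t => ?_⟩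
    · have h1 : t < z.u + 1 := by omega
      have h2 : t + 1 < z.u + 1 := by omega
      simp only [h1, h2, dif_pos]
      exact hf (by simp)
    · simp
    · simp [t.2]
  obtain ⟨I, hI, hm, eI⟩ := ext z.i z.i_strictMono
  obtain ⟨J, hJ, hn, eJ⟩ := ext z.j z.j_strictMono
  refine ⟨z.u, I, J, hI, hJ, hm, hn, fun K g x y => ?_⟩
  simp only [localValue, seqScore, eI, eJ, Fin.val_succ, Fin.val_castSucc]
  rw [Fin.sum_univ_eq_sum_range (fun t => K (x (I t)) (y (J t))),
    Fin.sum_univ_eq_sum_range (fun t => g (I (t + 1) - I t - 1) + g (J (t + 1) - J t - 1))]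

/-- The alignment that matches just the first letters of two nonempty words. -/
def single (k l : ℕ) : CandidateAlignment (k + 1) (l + 1) where
  u := 0
  i := fun _ => 0
  j := fun _ => 0
  i_strictMono := fun a b h => absurd (Fin.lt_def.1 h) (by omega)
  j_strictMono := fun a b h => absurd (Fin.lt_def.1 h) (by omega)

lemma localValue_single (k l : ℕ) (K : A → A → ℝ) (g : ℕ → ℝ) (x : Fin (k + 1) → A)
    (y : Fin (l + 1) → A) : (single k l).localValue K g x y = K (x 0) (y 0) := by
  change (∑ _t : Fin 1, K (x 0) (y 0)) - ∑ _t : Fin 0, _ = _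
  simp

instance instNonemptySucc (k l : ℕ) : Nonempty (CandidateAlignment (k + 1) (l + 1)) := ⟨single k l⟩

lemma u_lt (z : CandidateAlignment m n) : z.u < m := by
  simpa using Fintype.card_le_of_injective _ z.i_strictMono.injective

lemma localValue_le {K : A → A → ℝ} {g : ℕ → ℝ} {C : ℝ} (hC : 0 ≤ C) (hK : ∀ a b, |K a b| ≤ C)
    (hg : ∀ k, 0 ≤ g k) (z : CandidateAlignment m n) (x : Fin m → A) (y : Fin n → A) :
    z.localValue K g x y ≤ m * C := by
  have h1 : ∑ t, K (x (z.i t)) (y (z.j t)) ≤ ∑ _t : Fin (z.u + 1), C :=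
    Finset.sum_le_sum fun t _ => (abs_le.1 (hK _ _)).2
  have h2 : 0 ≤ ∑ t : Fin z.u, (g ((z.i t.succ : ℕ) - (z.i t.castSucc : ℕ) - 1)
          + g ((z.j t.succ : ℕ) - (z.j t.castSucc : ℕ) - 1)) :=
    Finset.sum_nonneg fun t _ => add_nonneg (hg _) (hg _)
  have h3 : ((z.u + 1 : ℕ) : ℝ) * C ≤ m * C :=
    mul_le_mul_of_nonneg_right (by exact_mod_cast z.u_lt) hC
  simp only [Finset.sum_const, Finset.card_univ, Fintype.card_fin, nsmul_eq_mul] at h1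
  unfold localValue
  linarith

lemma globalValue_le_localValue {K : A → A → ℝ} {g : ℕ → ℝ} (hg : ∀ k, 0 ≤ g k)
    (z : CandidateAlignment m n) (x : Fin m → A) (y : Fin n → A) :
    z.globalValue K g x y ≤ z.localValue K g x y := by
  unfold globalValue
  linarith [hg (z.i 0), hg (z.j 0), hg (m - 1 - (z.i (Fin.last z.u) : ℕ)),
    hg (n - 1 - (z.j (Fin.last z.u) : ℕ))]

lemma localValue_le_globalValue_add {K : A → A → ℝ} {g : ℕ → ℝ} (hg : Monotone g)
    (z : CandidateAlignment n n) (x : Fin n → A) (y : Fin n → A) :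
    z.localValue K g x y ≤ z.globalValue K g x y + 4 * g n := by
  unfold globalValue
  linarith [hg (z.i 0).2.le, hg (z.j 0).2.le,
    hg (show n - 1 - (z.i (Fin.last z.u) : ℕ) ≤ n by omega),
    hg (show n - 1 - (z.j (Fin.last z.u) : ℕ) ≤ n by omega)]

end CandidateAlignment

/-! ### Elementary bounds on alignment scores -/

section Scores

variable {A : Type*} {m n : ℕ} {K : A → A → ℝ} {g : ℕ → ℝ} {C : ℝ}

lemma bddAbove_localValue (hC : 0 ≤ C) (hK : ∀ a b, |K a b| ≤ C) (hg : ∀ k, 0 ≤ g k)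
    (x : Fin m → A) (y : Fin n → A) :
    BddAbove (Set.range fun z : CandidateAlignment m n => z.localValue K g x y) :=
  ⟨m * C, by rintro _ ⟨z, rfl⟩; exact z.localValue_le hC hK hg x y⟩

lemma seqScore_le_localScore (hC : 0 ≤ C) (hK : ∀ a b, |K a b| ≤ C) (hg : ∀ k, 0 ≤ g k)
    (x y : ℕ → A) {u : ℕ} {I J : ℕ → ℕ} (hI : ∀ t < u, I t < I (t + 1))
    (hJ : ∀ t < u, J t < J (t + 1)) (hm : I u < m) (hn : J u < n) :
    seqScore K g x y u I J ≤
      localScore K g (fun s : Fin m => x s) (fun s : Fin n => y s) := by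
  obtain ⟨z, hz⟩ := CandidateAlignment.exists_of_seq (A := A) hI hJ hm hn
  rw [← hz]
  exact le_ciSup (bddAbove_localValue hC hK hg _ _) z

lemma exists_seq_of_lt_localScore [NeZero m] [NeZero n] (x y : ℕ → A) {t : ℝ}
    (h : t < localScore K g (fun s : Fin m => x s) (fun s : Fin n => y s)) :
    ∃ (u : ℕ) (I J : ℕ → ℕ), (∀ t < u, I t < I (t + 1)) ∧ (∀ t < u, J t < J (t + 1)) ∧
      I u < m ∧ J u < n ∧ t < seqScore K g x y u I J := by
  obtain ⟨k, rfl⟩ := Nat.exists_eq_succ_of_ne_zero (NeZero.ne m)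
  obtain ⟨l, rfl⟩ := Nat.exists_eq_succ_of_ne_zero (NeZero.ne n)
  obtain ⟨z, hz⟩ := exists_lt_of_lt_ciSup h
  obtain ⟨u, I, J, hI, hJ, hm, hn, e⟩ := z.exists_seq (A := A)
  exact ⟨u, I, J, hI, hJ, hm, hn, by rwa [e] at hz⟩

lemma neg_le_localScore (hC : 0 ≤ C) (hK : ∀ a b, |K a b| ≤ C) (hg : ∀ k, 0 ≤ g k)
    (hn : 0 < n) (x : Fin n → A) (y : Fin n → A) : -C ≤ localScore K g x y := by
  obtain ⟨k, rfl⟩ := Nat.exists_eq_succ_of_ne_zero hn.ne'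
  have h := le_ciSup (bddAbove_localValue hC hK hg x y) (CandidateAlignment.single k k)
  rw [CandidateAlignment.localValue_single] at h
  exact (abs_le.1 (hK (x 0) (y 0))).1.trans h

lemma abs_localScore_le (hC : 0 ≤ C) (hK : ∀ a b, |K a b| ≤ C) (hg : ∀ k, 0 ≤ g k)
    (x : Fin n → A) (y : Fin n → A) : |localScore K g x y| ≤ n * C := by
  rcases Nat.eq_zero_or_pos n with rfl | hn
  · have : IsEmpty (CandidateAlignment 0 0) := ⟨fun z => (z.i 0).elim0⟩
    simp [localScore]
  · have h := neg_le_localScore hC hK hg hn x y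
    obtain ⟨k, rfl⟩ := Nat.exists_eq_succ_of_ne_zero hn.ne'
    refine abs_le.2 ⟨le_trans ?_ h, ciSup_le fun z => z.localValue_le hC hK hg x y⟩
    push_cast
    nlinarith

/-- Extending a local alignment to a global one costs at most the four end gaps. -/
lemma abs_globalScore_sub_localScore_le (hC : 0 ≤ C) (hK : ∀ a b, |K a b| ≤ C)
    (hg : ∀ k, 0 ≤ g k) (hmono : Monotone g) (x : Fin n → A) (y : Fin n → A) :
    |globalScore K g x y - localScore K g x y| ≤ 4 * g n := by
  rcases Nat.eq_zero_or_pos n with rfl | hn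
  · have : IsEmpty (CandidateAlignment 0 0) := ⟨fun z => (z.i 0).elim0⟩
    simpa [localScore, globalScore] using hg 0
  · obtain ⟨k, rfl⟩ := Nat.exists_eq_succ_of_ne_zero hn.ne'
    have hb := bddAbove_localValue hC hK hg x y
    have hb' : BddAbove (Set.range fun z : CandidateAlignment (k + 1) (k + 1) =>
        z.globalValue K g x y) := by
      obtain ⟨B, hB⟩ := hb
      refine ⟨B, ?_⟩
      rintro _ ⟨z, rfl⟩
      exact (z.globalValue_le_localValue hg x y).trans (hB ⟨z, rfl⟩)
    have h1 : globalScore K g x y ≤ localScore K g x y :=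
      ciSup_mono hb fun z => z.globalValue_le_localValue hg x y
    have h2 : localScore K g x y ≤ globalScore K g x y + 4 * g (k + 1) :=
      ciSup_le fun z => (z.localValue_le_globalValue_add hmono x y).trans
        (by gcongr; exact le_ciSup hb' z)
    have := hg (k + 1)
    exact abs_le.2 ⟨by linarith, by linarith⟩

/-! ### Chaining windows -/

/-- Two alignments are glued by placing the second one, taken in the words shifted by `N`, behind
the first one; the only extra cost is the gap between them. -/
lemma seqScore_glue (x y : ℕ → A) {u₁ u₂ N : ℕ} (I₁ J₁ I₂ J₂ : ℕ → ℕ) :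
    seqScore K g x y (u₁ + 1 + u₂)
        (fun t => if t ≤ u₁ then I₁ t else N + I₂ (t - (u₁ + 1)))
        (fun t => if t ≤ u₁ then J₁ t else N + J₂ (t - (u₁ + 1))) =
      seqScore K g x y u₁ I₁ J₁
        + seqScore K g (fun s => x (N + s)) (fun s => y (N + s)) u₂ I₂ J₂
        - (g (N + I₂ 0 - I₁ u₁ - 1) + g (N + J₂ 0 - J₁ u₁ - 1)) := by
  have e1 : ∀ t ∈ Finset.range (u₁ + 1), t ≤ u₁ := fun t ht => by
    simp at ht; omega
  have e2 : ∀ t ∈ Finset.range u₁, t ≤ u₁ ∧ t + 1 ≤ u₁ := fun t ht => by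
    simp at ht; omega
  have n1 : ∀ t, ¬ (u₁ + 1 + t ≤ u₁) := by omega
  have n2 : ∀ t, ¬ (u₁ + 1 + t + 1 ≤ u₁) := by omega
  have s2 : ∀ t, u₁ + 1 + t + 1 - (u₁ + 1) = t + 1 := by omega
  have s3 : ∀ a b, N + a - (N + b) - 1 = a - b - 1 := by omega
  unfold seqScore
  rw [show u₁ + 1 + u₂ + 1 = u₁ + 1 + (u₂ + 1) by ring, Finset.sum_range_add,
    Finset.sum_range_add _ (u₁ + 1) u₂, Finset.sum_range_succ (n := u₁) (f := fun t => g _ + g _)]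
  have c1 : ∑ t ∈ Finset.range (u₁ + 1),
      K (x (if t ≤ u₁ then I₁ t else N + I₂ (t - (u₁ + 1))))
        (y (if t ≤ u₁ then J₁ t else N + J₂ (t - (u₁ + 1)))) =
      ∑ t ∈ Finset.range (u₁ + 1), K (x (I₁ t)) (y (J₁ t)) :=
    Finset.sum_congr rfl fun t ht => by rw [if_pos (e1 t ht), if_pos (e1 t ht)]
  have c2 : ∑ t ∈ Finset.range u₁,
      (g ((if t + 1 ≤ u₁ then I₁ (t + 1) else N + I₂ (t + 1 - (u₁ + 1)))
          - (if t ≤ u₁ then I₁ t else N + I₂ (t - (u₁ + 1))) - 1)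
        + g ((if t + 1 ≤ u₁ then J₁ (t + 1) else N + J₂ (t + 1 - (u₁ + 1)))
          - (if t ≤ u₁ then J₁ t else N + J₂ (t - (u₁ + 1))) - 1)) =
      ∑ t ∈ Finset.range u₁, (g (I₁ (t + 1) - I₁ t - 1) + g (J₁ (t + 1) - J₁ t - 1)) :=
    Finset.sum_congr rfl fun t ht => by
      rw [if_pos (e2 t ht).1, if_pos (e2 t ht).1, if_pos (e2 t ht).2, if_pos (e2 t ht).2]
  rw [c1, c2]
  simp only [n1, n2, if_false, s2, s3, Nat.add_sub_cancel_left, le_refl, if_true,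
    Nat.not_succ_le_self, Nat.sub_self]
  ring

/-- Alignments found in consecutive windows of length `N` are joined into one alignment, at the cost
of two gaps of length at most `2 N` for each joint. The alignment ends in the last window. -/
lemma exists_seq_chain {N : ℕ} [NeZero N] (hmono : Monotone g) (x y : ℕ → A) {t : ℕ → ℝ} (q : ℕ)
    (h : ∀ k, t k < localScore K g (fun s : Fin N => x (N * k + s))
      (fun s : Fin N => y (N * k + s))) :
    ∃ (u : ℕ) (I J : ℕ → ℕ), (∀ t < u, I t < I (t + 1)) ∧ (∀ t < u, J t < J (t + 1)) ∧
      N * q ≤ I u ∧ I u < N * (q + 1) ∧ N * q ≤ J u ∧ J u < N * (q + 1) ∧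
      (∑ k ∈ Finset.range (q + 1), t k) - 2 * q * g (2 * N) ≤ seqScore K g x y u I J := by
  have hN : 0 < N := NeZero.pos N
  induction q with
  | zero =>
    obtain ⟨u, I, J, hI, hJ, hm, hn, hz⟩ :=
      exists_seq_of_lt_localScore (m := N) (n := N)
        (fun s => x (N * 0 + s)) (fun s => y (N * 0 + s)) (h 0)
    exact ⟨u, I, J, hI, hJ, by simp, by simpa using hm, by simp, by simpa using hn,
      by simpa using hz.le⟩
  | succ q ih =>
    obtain ⟨u₁, I₁, J₁, hI₁, hJ₁, hm₁, hm₁', hn₁, hn₁', hz₁⟩ := ih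
    obtain ⟨u₂, I₂, J₂, hI₂, hJ₂, hm₂, hn₂, hz₂⟩ :=
      exists_seq_of_lt_localScore (m := N) (n := N)
        (fun s => x (N * (q + 1) + s)) (fun s => y (N * (q + 1) + s)) (h (q + 1))
    have first : ∀ F : ℕ → ℕ, (∀ t < u₂, F t < F (t + 1)) → F 0 ≤ F u₂ := by
      intro F hF
      have : ∀ t ≤ u₂, F 0 ≤ F t := by
        intro t
        induction t with
        | zero => simp
        | succ t iht => intro ht; have := hF t (by omega); have := iht (by omega); omega
      exact this u₂ le_rfl
    have fI := first I₂ hI₂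
    have fJ := first J₂ hJ₂
    have glue : ∀ F₁ F₂ : ℕ → ℕ, (∀ t < u₁, F₁ t < F₁ (t + 1)) → (∀ t < u₂, F₂ t < F₂ (t + 1)) →
        F₁ u₁ < N * (q + 1) → ∀ t < u₁ + 1 + u₂,
        (if t ≤ u₁ then F₁ t else N * (q + 1) + F₂ (t - (u₁ + 1))) <
          (if t + 1 ≤ u₁ then F₁ (t + 1) else N * (q + 1) + F₂ (t + 1 - (u₁ + 1))) := by
      intro F₁ F₂ h1 h2 h3 t ht
      rcases lt_trichotomy t u₁ with hlt | rfl | hgt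
      · rw [if_pos hlt.le, if_pos (by omega)]
        exact h1 t hlt
      · rw [if_pos le_rfl, if_neg (by omega)]
        omega
      · rw [if_neg (by omega), if_neg (by omega)]
        have := h2 (t - (u₁ + 1)) (by omega)
        rw [show t - (u₁ + 1) + 1 = t + 1 - (u₁ + 1) by omega] at this
        omega
    have hend : ¬ (u₁ + 1 + u₂ ≤ u₁) := by omega
    have hq : N * (q + 1 + 1) = N * (q + 1) + N := by ring
    have hq' : N * (q + 1) = N * q + N := by ring
    refine ⟨u₁ + 1 + u₂, _, _, glue I₁ I₂ hI₁ hI₂ hm₁', glue J₁ J₂ hJ₁ hJ₂ hn₁', ?_, ?_, ?_, ?_, ?_⟩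
    · simp only [hend, if_false]; omega
    · simp only [hend, if_false, Nat.add_sub_cancel_left]; omega
    · simp only [hend, if_false]; omega
    · simp only [hend, if_false, Nat.add_sub_cancel_left]; omega
    · rw [seqScore_glue, Finset.sum_range_succ]
      have g1 := hmono (show N * (q + 1) + I₂ 0 - I₁ u₁ - 1 ≤ 2 * N by omega)
      have g2 := hmono (show N * (q + 1) + J₂ 0 - J₁ u₁ - 1 ≤ 2 * N by omega)
      push_cast
      linarith

lemma sum_localScore_windows_le (hC : 0 ≤ C) (hK : ∀ a b, |K a b| ≤ C) (hg : ∀ k, 0 ≤ g k)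
    (hmono : Monotone g) {N q : ℕ} (hN : N ≠ 0) (hq : q ≠ 0) (hn : N * q ≤ n) (x y : ℕ → A) :
    (∑ k ∈ Finset.range q, localScore K g (fun s : Fin N => x (N * k + s))
      (fun s : Fin N => y (N * k + s))) - 2 * q * g (2 * N) ≤
      localScore K g (fun s : Fin n => x s) (fun s : Fin n => y s) := by
  have : NeZero N := ⟨hN⟩
  obtain ⟨q, rfl⟩ := Nat.exists_eq_succ_of_ne_zero hq
  refine le_of_forall_pos_le_add fun ε hε => ?_
  have hq : (0 : ℝ) < q + 1 := by positivity
  obtain ⟨u, I, J, hI, hJ, -, hm, -, hn', hz⟩ := exists_seq_chain (N := N) (K := K) hmono x y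
    (t := fun k => localScore K g (fun s : Fin N => x (N * k + s))
      (fun s : Fin N => y (N * k + s)) - ε / (q + 1)) q
    (fun k => sub_lt_self _ (by positivity))
  have h1 := seqScore_le_localScore (m := n) (n := n) hC hK hg x y hI hJ
    (by simp only [Nat.succ_eq_add_one] at hn; omega)
    (by simp only [Nat.succ_eq_add_one] at hn; omega)
  rw [Finset.sum_sub_distrib, Finset.sum_const, Finset.card_range, nsmul_eq_mul] at hz
  push_cast at hz ⊢
  rw [mul_div_cancel₀ _ hq.ne'] at hz
  have := hg (2 * N)
  linarith

/-- Every ungapped alignment of two factors of length `ℓ` bounds the local score from below. -/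
lemma sum_diagonal_le_localScore (hg0 : g 0 = 0) (hC : 0 ≤ C) (hK : ∀ a b, |K a b| ≤ C)
    (hg : ∀ k, 0 ≤ g k) (x y : ℕ → A) {a b ℓ : ℕ} (hℓ : ℓ ≠ 0) (ha : a + ℓ ≤ n)
    (hb : b + ℓ ≤ n) :
    ∑ s : Fin ℓ, K (x (a + s)) (y (b + s)) ≤
      localScore K g (fun s : Fin n => x s) (fun s : Fin n => y s) := by
  obtain ⟨u, rfl⟩ := Nat.exists_eq_succ_of_ne_zero hℓ
  have h := seqScore_le_localScore (m := n) (n := n) (u := u) (I := fun t => a + t)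
    (J := fun t => b + t) hC hK hg x y (fun t _ => by simp) (fun t _ => by simp) (by omega)
    (by omega)
  rw [seqScore] at h
  rw [Fin.sum_univ_eq_sum_range (fun s => K (x (a + s)) (y (b + s)))]
  have z : ∀ c t : ℕ, c + (t + 1) - (c + t) - 1 = 0 := by omega
  simpa [z, hg0] using h

end Scores

/-! ### Grouping independent letters -/

section Grouping

variable {Ω A ι κ η : Type*} [MeasurableSpace Ω] [MeasurableSpace A] {P : Measure Ω}
  {μ : Measure A} {Z : η → Ω → A}

lemma measurable_randomWord {X : ℕ → Ω → A} (hX : ∀ i, Measurable (X i)) (n : ℕ) :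
    Measurable (randomWord X n) :=
  measurable_pi_lambda _ fun i => hX i

/-- Disjoint groups of independent variables are independent. -/
lemma iIndepFun_group [IsProbabilityMeasure P] (hZ : iIndepFun Z P) (hm : ∀ i, Measurable (Z i)) {f : ι × κ → η}
    (hf : f.Injective) : iIndepFun (fun (i : ι) ω (k : κ) => Z (f (i, k)) ω) P := by
  have h1 : iIndepFun (fun p : ι × κ => Z (f p)) P := hZ.precomp hf
  have hprob : ∀ p : ι × κ, IsProbabilityMeasure (P.map (Z (f p))) := fun p =>
    Measure.isProbabilityMeasure_map (hm _).aemeasurable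
  rw [iIndepFun_iff_map_fun_eq_infinitePi_map (fun i => by fun_prop)]
  have h2 := iIndepFun.map_fun_eq_infinitePi_map (fun p => hm (f p)) h1
  have h3 : ∀ i, P.map (fun ω (k : κ) => Z (f (i, k)) ω) =
      Measure.infinitePi fun k => P.map (Z (f (i, k))) := fun i =>
    iIndepFun.map_fun_eq_infinitePi_map (fun k => hm (f (i, k)))
      (hZ.precomp (g := fun k => f (i, k)) fun a b h => (Prod.ext_iff.1 (hf h)).2)
  simp_rw [h3]
  have h4 := Measure.infinitePi_map_curry (fun (i : ι) (k : κ) => P.map (Z (f (i, k))))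
  rw [← h4, ← h2, Measure.map_map (by fun_prop) (by fun_prop)]
  rfl

lemma map_group_eq_pi [Fintype κ] (hZ : iIndepFun Z P) (hm : ∀ i, Measurable (Z i))
    (hlaw : ∀ i, P.map (Z i) = μ) {f : κ → η} (hf : f.Injective) :
    P.map (fun ω k => Z (f k) ω) = Measure.pi fun _ => μ := by
  have := (hZ.precomp hf).map_fun_eq_pi_map fun k => (hm (f k)).aemeasurable
  simpa [hlaw] using this

lemma map_pair_eq_prod [IsProbabilityMeasure P] (hZ : iIndepFun Z P) (hm : ∀ i, Measurable (Z i))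
    (hlaw : ∀ i, P.map (Z i) = μ) {i j : η} (hij : i ≠ j) :
    P.map (fun ω => (Z i ω, Z j ω)) = μ.prod μ := by
  rw [(hZ.indepFun hij).map_prod_eq_prod_map_map (hm i).aemeasurable (hm j).aemeasurable,
    hlaw, hlaw]

variable [Finite A] [MeasurableSingletonClass A]

/-- Matched pairs of letters at distinct positions are independent with law `μ ⊗ μ`. -/
lemma integral_prod_matches [IsProbabilityMeasure P] {Z : ℕ ⊕ ℕ → Ω → A} (hZ : iIndepFun Z P)
    (hm : ∀ i, Measurable (Z i)) (hlaw : ∀ i, P.map (Z i) = μ) {u : ℕ} {I J : Fin u → ℕ}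
    (hI : I.Injective) (hJ : J.Injective) (F : A → A → ℝ) :
    ∫ ω, ∏ t, F (Z (.inl (I t)) ω) (Z (.inr (J t)) ω) ∂P =
      (∫ p, F p.1 p.2 ∂(μ.prod μ)) ^ u := by
  let f : Fin u × Bool → ℕ ⊕ ℕ := fun p => if p.2 then .inr (J p.1) else .inl (I p.1)
  have hf : f.Injective := by
    rintro ⟨a, _ | _⟩ ⟨b, _ | _⟩ h <;> simp [f] at h ⊢
    · exact hI h
    · exact hJ h
  have h1 := iIndepFun_group hZ hm hf
  have h2 := h1.integral_fun_prod_comp (f := fun _ w => F (w false) (w true))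
    (fun t => Measurable.aemeasurable (by fun_prop))
    (fun t => (Measurable.of_discrete).aestronglyMeasurable)
  simp only [f, Bool.false_eq_true, if_false, if_true] at h2
  rw [h2]
  have h3 : ∀ t, ∫ ω, F (Z (.inl (I t)) ω) (Z (.inr (J t)) ω) ∂P =
      ∫ p, F p.1 p.2 ∂(μ.prod μ) := by
    intro t
    rw [← map_pair_eq_prod hZ hm hlaw (i := .inl (I t)) (j := .inr (J t)) (by simp),
      integral_map (by fun_prop) (Measurable.of_discrete).aestronglyMeasurable]
  simp [h3]

end Grouping

/-! ### Exponential moments of the similarity -/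

lemma sum_sum_pos_of_pos {A : Type*} [Fintype A] [MeasurableSpace A] {μ : Measure A}
    (hμ : ∀ a, 0 < μ.real {a}) {F : A → A → ℝ}
    (hF : ∀ a b, 0 ≤ F a b) (hpos : ∃ a b, 0 < F a b) : 0 < ∑ a, ∑ b, μ.real {a} * μ.real {b} * F a b := by
  have hn : ∀ a b, 0 ≤ μ.real {a} * μ.real {b} * F a b := fun a b =>
    mul_nonneg (mul_nonneg (hμ a).le (hμ b).le) (hF a b)
  obtain ⟨a, b, h⟩ := hpos
  refine Finset.sum_pos' (fun a _ => Finset.sum_nonneg fun b _ => hn a b) ⟨a, Finset.mem_univ _, ?_⟩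
  exact Finset.sum_pos' (fun b _ => hn a b) ⟨b, Finset.mem_univ _,
    mul_pos (mul_pos (hμ a) (hμ b)) h⟩

section Moments

variable {A : Type*} [Fintype A] [MeasurableSpace A] [MeasurableSingletonClass A]
  {μ : Measure A} [IsProbabilityMeasure μ] {K : A → A → ℝ} {θ : ℝ}

lemma integral_prod_eq_sum (F : A → A → ℝ) :
    ∫ p, F p.1 p.2 ∂(μ.prod μ) = ∑ a, ∑ b, μ.real {a} * μ.real {b} * F a b := by
  rw [integral_prod _ .of_finite, integral_fintype .of_finite]
  refine Finset.sum_congr rfl fun a _ => ?_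
  rw [integral_fintype .of_finite]
  simp only [smul_eq_mul, Finset.mul_sum, mul_assoc]

lemma sum_sum_measureReal_eq_one : ∑ a, ∑ b, μ.real {a} * μ.real {b} = 1 := by
  simp [← Finset.mul_sum]

/-- Strictly between the two roots `0` and `θ` the exponential moment of `K` is below `1`. -/
lemma expMoment_lt_one (hμ : ∀ a, 0 < μ.real {a}) (hKpos : ∃ a b, 0 < K a b)
    (hroot : ∑ a, ∑ b, μ.real {a} * μ.real {b} * Real.exp (θ * K a b) = 1) {θ' : ℝ}
    (h0 : 0 < θ') (h1 : θ' < θ) :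
    ∑ a, ∑ b, μ.real {a} * μ.real {b} * Real.exp (θ' * K a b) < 1 := by
  have hθ : 0 < θ := h0.trans h1
  set s := θ' / θ with hs
  have hs0 : 0 < s := div_pos h0 hθ
  have hs1 : s < 1 := (div_lt_one hθ).2 h1
  have e : ∀ a b, θ' * K a b = s * (θ * K a b) := fun a b => by rw [hs]; field_simp
  have conv : ∀ a b, θ * K a b ≠ 0 →
      Real.exp (s * (θ * K a b)) < (1 - s) + s * Real.exp (θ * K a b) := by
    intro a b hne
    have := strictConvexOn_exp.2 (Set.mem_univ (0 : ℝ)) (Set.mem_univ (θ * K a b)) hne.symm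
      (sub_pos.2 hs1) hs0 (by ring)
    simpa using this
  have hpos : 0 < ∑ a, ∑ b, μ.real {a} * μ.real {b} *
      ((1 - s) + s * Real.exp (θ * K a b) - Real.exp (θ' * K a b)) := by
    refine sum_sum_pos_of_pos hμ (fun a b => ?_) ?_
    · rw [e]
      rcases eq_or_ne (θ * K a b) 0 with h | h
      · simp [h]
      · linarith [conv a b h]
    · obtain ⟨a, b, h⟩ := hKpos
      refine ⟨a, b, ?_⟩
      rw [e]
      linarith [conv a b (mul_pos hθ h).ne']
  have hexp : ∑ a, ∑ b, μ.real {a} * μ.real {b} *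
      ((1 - s) + s * Real.exp (θ * K a b) - Real.exp (θ' * K a b)) =
      (1 - s) * (∑ a, ∑ b, μ.real {a} * μ.real {b})
      + s * (∑ a, ∑ b, μ.real {a} * μ.real {b} * Real.exp (θ * K a b))
      - ∑ a, ∑ b, μ.real {a} * μ.real {b} * Real.exp (θ' * K a b) := by
    simp only [Finset.mul_sum, ← Finset.sum_add_distrib, ← Finset.sum_sub_distrib]
    exact Finset.sum_congr rfl fun a _ => Finset.sum_congr rfl fun b _ => by ring
  rw [hexp, sum_sum_measureReal_eq_one, hroot] at hpos
  linarith

end Moments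

/-! ### The union bound over alignments -/

/-- Summing a product of gap weights over all increasing position sequences: such a sequence is
determined by its first position and its gaps. -/
lemma sum_strictMono_prod_gap_le {n u : ℕ} {w : ℕ → ℝ} {D : ℝ} (hw : ∀ k, 0 ≤ w k)
    (hD : ∑ k ∈ Finset.range n, w k ≤ D) [DecidablePred (StrictMono (α := Fin (u + 1))
      (β := Fin n))] :
    ∑ i : Fin (u + 1) → Fin n with StrictMono i,
      ∏ t : Fin u, w ((i t.succ : ℕ) - (i t.castSucc : ℕ) - 1) ≤ n * D ^ u := by
  let code : (Fin (u + 1) → Fin n) → Fin n × (Fin u → Fin n) := fun i =>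
    (i 0, fun t => ⟨(i t.succ : ℕ) - (i t.castSucc : ℕ) - 1, by omega⟩)
  have inj : Set.InjOn code
      (Finset.univ.filter fun i : Fin (u + 1) → Fin n => StrictMono i) := by
    intro i hi i' hi' h
    simp only [Finset.coe_filter, Finset.mem_univ, true_and, Set.mem_ofPred_eq] at hi hi'
    obtain ⟨h0, hg⟩ := Prod.ext_iff.1 h
    funext t
    induction t using Fin.induction with
    | zero => exact h0
    | succ t ih =>
      have h1 := congrArg Fin.val (congrFun hg t)
      have h2 := Fin.lt_def.1 (hi (Fin.castSucc_lt_succ (i := t)))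
      have h3 := Fin.lt_def.1 (hi' (Fin.castSucc_lt_succ (i := t)))
      simp only [code] at h1
      rw [ih] at h1 h2
      exact Fin.ext (by omega)
  calc ∑ i : Fin (u + 1) → Fin n with StrictMono i,
        ∏ t : Fin u, w ((i t.succ : ℕ) - (i t.castSucc : ℕ) - 1)
      = ∑ c ∈ (Finset.univ.filter fun i : Fin (u + 1) → Fin n => StrictMono i).image code,
          ∏ t, w (c.2 t) := by
        rw [Finset.sum_image inj]
    _ ≤ ∑ c : Fin n × (Fin u → Fin n), ∏ t, w (c.2 t) :=
        Finset.sum_le_sum_of_subset_of_nonneg (Finset.subset_univ _)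
          fun c _ _ => Finset.prod_nonneg fun t _ => hw _
    _ = n * (∑ k ∈ Finset.range n, w k) ^ u := by
        rw [Fintype.sum_prod_type]
        simp only [Finset.sum_const, Finset.card_univ, Fintype.card_fin, nsmul_eq_mul]
        rw [← Fin.sum_univ_eq_sum_range, Fintype.sum_pow]
    _ ≤ n * D ^ u := by
        gcongr
        exact Finset.sum_nonneg fun k _ => hw k

section UpperBound

variable {Ω A : Type*} [MeasurableSpace Ω] [Fintype A] [MeasurableSpace A]
  [MeasurableSingletonClass A] {P : Measure Ω} [IsProbabilityMeasure P] {μ : Measure A}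
  [IsProbabilityMeasure μ] {Z : ℕ ⊕ ℕ → Ω → A} {K : A → A → ℝ} {g : ℕ → ℝ}

/-- The Chernoff bound for a single alignment. -/
lemma measureReal_le_localValue_le (hZ : iIndepFun Z P) (hm : ∀ i, Measurable (Z i))
    (hlaw : ∀ i, P.map (Z i) = μ) {θ' : ℝ} (h0 : 0 ≤ θ') {n : ℕ} (z : CandidateAlignment n n)
    (t : ℝ) :
    P.real {ω | t ≤ z.localValue K g (randomWord (fun i => Z (.inl i)) n ω)
        (randomWord (fun i => Z (.inr i)) n ω)} ≤
      Real.exp (-θ' * t) *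
        ((∑ a, ∑ b, μ.real {a} * μ.real {b} * Real.exp (θ' * K a b)) ^ (z.u + 1) *
          ((∏ s : Fin z.u, Real.exp (-θ' * g ((z.i s.succ : ℕ) - (z.i s.castSucc : ℕ) - 1))) *
          ∏ s : Fin z.u, Real.exp (-θ' * g ((z.j s.succ : ℕ) - (z.j s.castSucc : ℕ) - 1)))) := by
  have hexp : ∀ ω, Real.exp (θ' * z.localValue K g (randomWord (fun i => Z (.inl i)) n ω)
        (randomWord (fun i => Z (.inr i)) n ω)) =
      (∏ s, Real.exp (θ' * K (Z (.inl (z.i s)) ω) (Z (.inr (z.j s)) ω))) *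
        ((∏ s : Fin z.u, Real.exp (-θ' * g ((z.i s.succ : ℕ) - (z.i s.castSucc : ℕ) - 1))) *
          ∏ s : Fin z.u, Real.exp (-θ' * g ((z.j s.succ : ℕ) - (z.j s.castSucc : ℕ) - 1))) := by
    intro ω
    simp only [← Real.exp_sum, ← Real.exp_add, CandidateAlignment.localValue, randomWord,
      Finset.sum_add_distrib, ← Finset.mul_sum]
    congr 1
    ring
  have hint : Integrable (fun ω => Real.exp (θ' * z.localValue K g
      (randomWord (fun i => Z (.inl i)) n ω) (randomWord (fun i => Z (.inr i)) n ω))) P := by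
    have h : Integrable (fun w : (Fin n → A) × (Fin n → A) =>
        Real.exp (θ' * z.localValue K g w.1 w.2))
        (P.map fun ω => (randomWord (fun i => Z (.inl i)) n ω,
          randomWord (fun i => Z (.inr i)) n ω)) := .of_finite
    exact h.comp_measurable ((measurable_randomWord (fun i => hm _) n).prodMk
      (measurable_randomWord (fun i => hm _) n))
  refine (measure_ge_le_exp_mul_mgf t h0 hint).trans (le_of_eq ?_)
  unfold mgf
  simp only [hexp]
  rw [integral_mul_const, integral_prod_matches hZ hm hlaw (I := fun s => (z.i s : ℕ))
    (J := fun s => (z.j s : ℕ)) (F := fun a b => Real.exp (θ' * K a b))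
    (Fin.val_injective.comp z.i_strictMono.injective)
    (Fin.val_injective.comp z.j_strictMono.injective), integral_prod_eq_sum (fun a b => Real.exp (θ' * K a b))]

/-- The union bound over all alignments: a geometric series in the number of matches. -/
lemma measureReal_lt_localScore_le (hZ : iIndepFun Z P) (hm : ∀ i, Measurable (Z i))
    (hlaw : ∀ i, P.map (Z i) = μ) {θ' D : ℝ} (h0 : 0 ≤ θ')
    (hD : ∀ n, ∑ k ∈ Finset.range n, Real.exp (-θ' * g k) ≤ D)
    (hφ : ∑ a, ∑ b, μ.real {a} * μ.real {b} * Real.exp (θ' * K a b) ≤ 1)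
    (hφD : (∑ a, ∑ b, μ.real {a} * μ.real {b} * Real.exp (θ' * K a b)) * D ^ 2 < 1)
    {n : ℕ} [NeZero n] (t : ℝ) :
    P.real {ω | t < localScore K g (randomWord (fun i => Z (.inl i)) n ω)
        (randomWord (fun i => Z (.inr i)) n ω)} ≤
      Real.exp (-θ' * t) * (n ^ 2 *
        (1 - (∑ a, ∑ b, μ.real {a} * μ.real {b} * Real.exp (θ' * K a b)) * D ^ 2)⁻¹) := by
  classical
  set φ := ∑ a, ∑ b, μ.real {a} * μ.real {b} * Real.exp (θ' * K a b) with hφdef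
  have hφ0 : 0 ≤ φ := Finset.sum_nonneg fun a _ => Finset.sum_nonneg fun b _ => by positivity
  let F : (u : ℕ) → (Fin (u + 1) → Fin n) → ℝ := fun u i =>
    ∏ s : Fin u, Real.exp (-θ' * g ((i s.succ : ℕ) - (i s.castSucc : ℕ) - 1))
  let E : (u : ℕ) → (Fin (u + 1) → Fin n) → (Fin (u + 1) → Fin n) → Set Ω := fun u i j =>
    {ω | ∃ (hi : StrictMono i) (hj : StrictMono j),
      t ≤ (CandidateAlignment.mk u i j hi hj).localValue K g (randomWord (fun i => Z (.inl i)) n ω)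
        (randomWord (fun i => Z (.inr i)) n ω)}
  have hE : ∀ u i j, StrictMono i → StrictMono j →
      P.real (E u i j) ≤ Real.exp (-θ' * t) * (φ ^ (u + 1) * (F u i * F u j)) := by
    intro u i j hi hj
    refine le_trans (measureReal_mono ?_) (measureReal_le_localValue_le (K := K) (g := g) hZ hm
      hlaw h0 ⟨u, i, j, hi, hj⟩ t)
    rintro ω ⟨_, _, h⟩
    exact h
  have hsub : {ω | t < localScore K g (randomWord (fun i => Z (.inl i)) n ω)
        (randomWord (fun i => Z (.inr i)) n ω)} ⊆
      ⋃ u ∈ Finset.range n, ⋃ i ∈ Finset.univ.filter fun i : Fin (u + 1) → Fin n => StrictMono i,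
        ⋃ j ∈ Finset.univ.filter fun i : Fin (u + 1) → Fin n => StrictMono i, E u i j := by
    intro ω hω
    obtain ⟨k, rfl⟩ := Nat.exists_eq_succ_of_ne_zero (NeZero.ne n)
    obtain ⟨z, hz⟩ := exists_lt_of_lt_ciSup (Set.mem_ofPred_eq ▸ hω)
    simp only [Set.mem_iUnion, Finset.mem_range, Finset.mem_filter, Finset.mem_univ, true_and]
    exact ⟨z.u, z.u_lt, z.i, z.i_strictMono, z.j, z.j_strictMono, z.i_strictMono, z.j_strictMono,
      hz.le⟩
  have hF0 : ∀ u i, 0 ≤ F u i := fun u i => Finset.prod_nonneg fun s _ => (Real.exp_pos _).le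
  have hD0 : 0 ≤ D := le_trans (by simp) (hD 0)
  calc _ ≤ ∑ u ∈ Finset.range n, ∑ i : Fin (u + 1) → Fin n with StrictMono i,
        ∑ j : Fin (u + 1) → Fin n with StrictMono j, P.real (E u i j) := by
        refine (measureReal_mono hsub (measure_ne_top _ _)).trans ?_
        refine (measureReal_biUnion_finset_le _ _).trans (Finset.sum_le_sum fun u _ => ?_)
        refine (measureReal_biUnion_finset_le _ _).trans (Finset.sum_le_sum fun i _ => ?_)
        exact measureReal_biUnion_finset_le _ _
    _ ≤ ∑ u ∈ Finset.range n, ∑ i : Fin (u + 1) → Fin n with StrictMono i,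
        ∑ j : Fin (u + 1) → Fin n with StrictMono j,
          Real.exp (-θ' * t) * (φ ^ (u + 1) * (F u i * F u j)) :=
        Finset.sum_le_sum fun u _ => Finset.sum_le_sum fun i hi => Finset.sum_le_sum fun j hj =>
          hE u i j (Finset.mem_filter.1 hi).2 (Finset.mem_filter.1 hj).2
    _ = Real.exp (-θ' * t) * ∑ u ∈ Finset.range n, φ ^ (u + 1) *
          ((∑ i : Fin (u + 1) → Fin n with StrictMono i, F u i) *
            ∑ j : Fin (u + 1) → Fin n with StrictMono j, F u j) := by
        simp only [Finset.sum_mul_sum]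
        simp only [Finset.mul_sum]
    _ ≤ Real.exp (-θ' * t) * ∑ u ∈ Finset.range n, n ^ 2 * (φ * D ^ 2) ^ u := by
        refine mul_le_mul_of_nonneg_left (Finset.sum_le_sum fun u _ => ?_) (Real.exp_pos _).le
        have h1 : ∑ i : Fin (u + 1) → Fin n with StrictMono i, F u i ≤ n * D ^ u :=
          sum_strictMono_prod_gap_le (w := fun k => Real.exp (-θ' * g k))
            (fun k => (Real.exp_pos _).le) (hD n)
        have h2 : 0 ≤ ∑ i : Fin (u + 1) → Fin n with StrictMono i, F u i :=
          Finset.sum_nonneg fun i _ => hF0 u i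
        calc _ ≤ φ ^ u * ((n * D ^ u) * (n * D ^ u)) := by
              gcongr ?_ * (?_ * ?_)
              rw [pow_succ]
              exact mul_le_of_le_one_right (pow_nonneg hφ0 u) hφ
          _ = _ := by ring
    _ ≤ _ := by
        rw [← Finset.mul_sum]
        gcongr
        have hr0 : 0 ≤ φ * D ^ 2 := by positivity
        rw [← tsum_geometric_of_lt_one hr0 hφD]
        exact (summable_geometric_of_lt_one hr0 hφD).sum_le_tsum _ fun u _ => pow_nonneg hr0 u

/-- With a summable gap weight and an expensive gap opening, the local score exceeds a multiple
of `log n` with vanishing probability. -/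
lemma tendsto_measureReal_mul_log_lt_localScore (hZ : iIndepFun Z P) (hm : ∀ i, Measurable (Z i))
    (hlaw : ∀ i, P.map (Z i) = μ) {θ' D : ℝ} (h0 : 0 < θ')
    (hD : ∀ n, ∑ k ∈ Finset.range n, Real.exp (-θ' * g k) ≤ D)
    (hφ : ∑ a, ∑ b, μ.real {a} * μ.real {b} * Real.exp (θ' * K a b) ≤ 1)
    (hφD : (∑ a, ∑ b, μ.real {a} * μ.real {b} * Real.exp (θ' * K a b)) * D ^ 2 < 1) :
    Tendsto (fun n : ℕ => P.real {ω | 3 / θ' * Real.log n < localScore K g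
      (randomWord (fun i => Z (.inl i)) n ω) (randomWord (fun i => Z (.inr i)) n ω)})
      atTop (𝓝 0) := by
  set B := (1 - (∑ a, ∑ b, μ.real {a} * μ.real {b} * Real.exp (θ' * K a b)) * D ^ 2)⁻¹ with hB
  have hlim : Tendsto (fun n : ℕ => B * (n : ℝ)⁻¹) atTop (𝓝 0) := by
    simpa using tendsto_inv_atTop_nhds_zero_nat.const_mul B
  refine squeeze_zero' (Eventually.of_forall fun n => measureReal_nonneg) ?_ hlim
  filter_upwards [eventually_gt_atTop 0] with n hn
  have : NeZero n := ⟨hn.ne'⟩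
  refine (measureReal_lt_localScore_le hZ hm hlaw h0.le hD hφ hφD _).trans (le_of_eq ?_)
  have hn' : (0 : ℝ) < n := by exact_mod_cast hn
  have : Real.exp (-θ' * (3 / θ' * Real.log n)) = ((n : ℝ) ^ 3)⁻¹ := by
    rw [show -θ' * (3 / θ' * Real.log n) = -(3 * Real.log n) by field_simp, Real.exp_neg,
      show (3 : ℝ) * Real.log n = Real.log ((n : ℝ) ^ 3) by simp, Real.exp_log (by positivity)]
  rw [this, ← hB]
  field_simp

end UpperBound

/-! ### A second moment bound for pairs of independent blocks -/

section SecondMoment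

variable {Ω B η : Type*} [MeasurableSpace Ω] [MeasurableSpace B] [Finite B]
  [MeasurableSingletonClass B] {P : Measure Ω} [IsProbabilityMeasure P] {ν : Measure B}
  [IsProbabilityMeasure ν]

lemma integral_pair_eq {W : η → Ω → B} (hW : iIndepFun W P) (hm : ∀ i, Measurable (W i))
    (hlaw : ∀ i, P.map (W i) = ν) (F : B → B → ℝ) {a b : η} (hab : a ≠ b) :
    ∫ ω, F (W a ω) (W b ω) ∂P = ∫ u, ∫ v, F u v ∂ν ∂ν := by
  rw [← integral_prod (fun p : B × B => F p.1 p.2) .of_finite, ← map_pair_eq_prod hW hm hlaw hab,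
    integral_map (by fun_prop) (Measurable.of_discrete).aestronglyMeasurable]

lemma integral_mul_shared_le {W : η → Ω → B} (hW : iIndepFun W P) (hm : ∀ i, Measurable (W i))
    (hlaw : ∀ i, P.map (W i) = ν) {F : B → B → ℝ} (hF : ∀ u v, 0 ≤ F u v) {Q : ℝ}
    (hQ : ∀ u, ∫ v, F u v ∂ν ≤ Q) {a b c : η} (hab : a ≠ b) (hac : a ≠ c) (hbc : b ≠ c) :
    ∫ ω, F (W a ω) (W b ω) * F (W a ω) (W c ω) ∂P ≤ Q * ∫ u, ∫ v, F u v ∂ν ∂ν := by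
  have hind : IndepFun (W a) (fun ω => (W b ω, W c ω)) P :=
    (hW.indepFun_prodMk hm b c a hab.symm hac.symm).symm
  have hmap : P.map (fun ω => (W a ω, (W b ω, W c ω))) = ν.prod (ν.prod ν) := by
    rw [hind.map_prod_eq_prod_map_map (hm a).aemeasurable ((hm b).prodMk (hm c)).aemeasurable,
      hlaw, map_pair_eq_prod hW hm hlaw hbc]
  have h1 : ∫ ω, F (W a ω) (W b ω) * F (W a ω) (W c ω) ∂P =
      ∫ u, (∫ v, F u v ∂ν) * ∫ v, F u v ∂ν ∂ν := by
    have h2 : ∫ ω, F (W a ω) (W b ω) * F (W a ω) (W c ω) ∂P =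
        ∫ p, F p.1 p.2.1 * F p.1 p.2.2 ∂(ν.prod (ν.prod ν)) := by
      rw [← hmap, integral_map (by fun_prop) (Measurable.of_discrete).aestronglyMeasurable]
    rw [h2, integral_prod _ .of_finite]
    congr 1
    funext u
    exact integral_prod_mul (fun v => F u v) (fun v => F u v)
  rw [h1, ← integral_const_mul]
  refine integral_mono .of_finite .of_finite fun u => ?_
  exact mul_le_mul_of_nonneg_right (hQ u) (integral_nonneg fun v => hF u v)

/-- A second moment bound: among `M` independent blocks on each side some pair satisfies a relation
of probability `p` once `M ^ 2 * p` is large, provided that no single block satisfies it with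
too many partners (probability at most `Q`), so that sharing a block costs little. -/
lemma measureReal_forall_not_rel_le {W : ℕ ⊕ ℕ → Ω → B} (hW : iIndepFun W P)
    (hm : ∀ i, Measurable (W i)) (hlaw : ∀ i, P.map (W i) = ν) (E : B → B → Prop)
    [∀ u v, Decidable (E u v)] {Q p : ℝ}
    (hQ₁ : ∀ u, ∫ v, (if E u v then 1 else 0) ∂ν ≤ Q)
    (hQ₂ : ∀ v, ∫ u, (if E u v then 1 else 0) ∂ν ≤ Q)
    (hp : ∫ u, ∫ v, (if E u v then 1 else 0) ∂ν ∂ν = p) (hp0 : 0 < p) {M : ℕ} (hM : 0 < M) :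
    P.real {ω | ∀ i < M, ∀ j < M, ¬ E (W (.inl i) ω) (W (.inr j) ω)} ≤
      1 / (M ^ 2 * p) + 2 * Q / (M * p) := by
  set F : B → B → ℝ := fun u v => if E u v then 1 else 0 with hFdef
  have hF0 : ∀ u v, 0 ≤ F u v := fun u v => by simp only [hFdef]; split_ifs <;> norm_num
  have hFF : ∀ u v, F u v * F u v = F u v := fun u v => by
    simp only [hFdef]; split_ifs <;> norm_num
  have hp' : ∫ v, ∫ u, F u v ∂ν ∂ν = p := by
    rw [← hp]
    exact (integral_integral_swap (f := F) .of_finite).symm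
  have hQ0 : 0 ≤ Q := by
    obtain ⟨u⟩ : Nonempty B := nonempty_of_isProbabilityMeasure ν
    exact (integral_nonneg fun v => hF0 u v).trans (hQ₁ u)
  let R := Finset.range M ×ˢ Finset.range M
  let T : ℕ × ℕ → Ω → ℝ := fun r ω => F (W (.inl r.1) ω) (W (.inr r.2) ω)
  have hTm : ∀ r, Measurable (T r) := fun r =>
    (Measurable.of_discrete (f := fun w : B × B => F w.1 w.2)).comp ((hm _).prodMk (hm _))
  have hTb : ∀ r ω, ‖T r ω‖ ≤ 1 := fun r ω => by
    simp only [T, hFdef]; split_ifs <;> simp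
  have hTL : ∀ r, MemLp (T r) 2 P := fun r =>
    MemLp.of_bound (hTm r).aestronglyMeasurable 1 (ae_of_all _ (hTb r))
  let N : Ω → ℝ := fun ω => ∑ r ∈ R, T r ω
  have hNL : MemLp N 2 P := memLp_finsetSum R fun r _ => hTL r
  have hT1 : ∀ r, ∫ ω, T r ω ∂P = p := fun r => by
    rw [← hp]; exact integral_pair_eq hW hm hlaw F (by simp)
  have hN1 : ∫ ω, N ω ∂P = M ^ 2 * p := by
    simp only [N]
    rw [integral_finsetSum _ fun r _ => (hTL r).integrable (by norm_num)]
    simp [hT1, R, sq]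
  have hTT : ∀ r r', ∫ ω, T r ω * T r' ω ∂P ≤ p ^ 2 + (if r.1 = r'.1 then Q * p else 0) +
      (if r.2 = r'.2 then Q * p else 0) + (if r = r' then p else 0) := by
    rintro ⟨i, j⟩ ⟨i', j'⟩
    have hQp : 0 ≤ Q * p := by positivity
    have hp2 : 0 ≤ p ^ 2 := by positivity
    by_cases hi : i = i' <;> by_cases hj : j = j'
    · subst hi hj
      have h1 : ∫ ω, T (i, j) ω * T (i, j) ω ∂P = p := by
        rw [← hT1 (i, j)]
        simp only [T, hFF]
      simp only [if_true, h1]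
      linarith
    · subst hi
      have := integral_mul_shared_le hW hm hlaw hF0 hQ₁ (a := .inl i) (b := .inr j) (c := .inr j')
        (by simp) (by simp) (by simpa using hj)
      rw [hp] at this
      simp only [if_true, hj, if_false, Prod.mk.injEq, and_false]
      linarith
    · subst hj
      have := integral_mul_shared_le hW hm hlaw (F := fun v u => F u v) (fun v u => hF0 u v) hQ₂
        (a := .inr j) (b := .inl i) (c := .inl i') (by simp) (by simp) (by simpa using hi)
      rw [hp'] at this
      simp only [if_true, hi, if_false, Prod.mk.injEq, false_and]
      linarith
    · have hind := hW.indepFun_prodMk_prodMk hm (.inl i) (.inr j) (.inl i') (.inr j')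
        (by simpa using hi) (by simp) (by simp) (by simpa using hj)
      have hFm : Measurable fun w : B × B => F w.1 w.2 := .of_discrete
      have h1 := (hind.comp hFm hFm).integral_fun_mul_eq_mul_integral
        (hTm (i, j)).aestronglyMeasurable (hTm (i', j')).aestronglyMeasurable
      have h2 : ∫ ω, T (i, j) ω * T (i', j') ω ∂P = p * p := by
        rw [← hT1 (i, j)]
        nth_rw 2 [hT1 (i, j)]
        rw [← hT1 (i', j')]
        exact h1
      simp only [hi, hj, if_false, Prod.mk.injEq, false_and, h2]
      linarith [sq p]
  have hN2 : ∫ ω, N ω ^ 2 ∂P ≤ M ^ 4 * p ^ 2 + 2 * M ^ 3 * (Q * p) + M ^ 2 * p := by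
    have e : ∀ ω, N ω ^ 2 = ∑ r ∈ R, ∑ r' ∈ R, T r ω * T r' ω := fun ω => by
      rw [sq, Finset.sum_mul_sum]
    have hint : ∀ r r', Integrable (fun ω => T r ω * T r' ω) P := fun r r' =>
      (hTL r).integrable_mul (hTL r')
    simp only [e]
    rw [integral_finsetSum _ fun r _ => integrable_finsetSum _ fun r' _ => hint r r']
    simp only [integral_finsetSum _ fun r' _ => hint _ r']
    refine (Finset.sum_le_sum fun r _ => Finset.sum_le_sum fun r' _ => hTT r r').trans ?_
    have c1 : ∀ r ∈ R, ∑ r' ∈ R, (if r.1 = r'.1 then Q * p else 0) = M * (Q * p) := by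
      intro r hr
      simp only [R, Finset.mem_product, Finset.mem_range] at hr
      simp only [R, Finset.sum_product_right, Finset.sum_ite_eq, Finset.mem_range, hr.1, if_true]
      simp
    have c2 : ∀ r ∈ R, ∑ r' ∈ R, (if r.2 = r'.2 then Q * p else 0) = M * (Q * p) := by
      intro r hr
      simp only [R, Finset.mem_product, Finset.mem_range] at hr
      simp only [R, Finset.sum_product, Finset.sum_ite_eq, Finset.mem_range, hr.2, if_true]
      simp
    have c3 : ∀ r ∈ R, ∑ r' ∈ R, (if r = r' then p else 0) = p := by
      intro r hr
      simp [hr]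
    simp only [Finset.sum_add_distrib]
    rw [Finset.sum_congr rfl c1, Finset.sum_congr rfl c2, Finset.sum_congr rfl c3]
    simp only [R, Finset.sum_const, Finset.card_product, Finset.card_range, nsmul_eq_mul]
    push_cast
    apply le_of_eq
    ring
  have hM' : (0 : ℝ) < M := by exact_mod_cast hM
  have hNp : 0 < M ^ 2 * p := by positivity
  have hsub : {ω | ∀ i < M, ∀ j < M, ¬ E (W (.inl i) ω) (W (.inr j) ω)} ⊆
      {ω | M ^ 2 * p ≤ |N ω - ∫ ω, N ω ∂P|} := by
    intro ω hω
    have h0 : N ω = 0 := Finset.sum_eq_zero fun r hr => by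
      simp only [R, Finset.mem_product, Finset.mem_range] at hr
      simp only [T, hFdef, if_neg (hω r.1 hr.1 r.2 hr.2)]
    simp only [Set.mem_ofPred_eq, h0, hN1, zero_sub, abs_neg, abs_of_pos hNp, le_refl]
  have hcheb := meas_ge_le_variance_div_sq hNL hNp
  have hvar : Var[N; P] ≤ 2 * M ^ 3 * (Q * p) + M ^ 2 * p := by
    rw [variance_eq_sub hNL]
    have : P[N ^ 2] = ∫ ω, N ω ^ 2 ∂P := rfl
    rw [this, hN1]
    linarith [hN2, show (M ^ 2 * p) ^ 2 = M ^ 4 * p ^ 2 by ring]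
  calc _ ≤ P.real {ω | M ^ 2 * p ≤ |N ω - ∫ ω, N ω ∂P|} := measureReal_mono hsub
    _ ≤ Var[N; P] / (M ^ 2 * p) ^ 2 :=
        ENNReal.toReal_le_of_le_ofReal (div_nonneg (variance_nonneg _ _) (sq_nonneg _)) hcheb
    _ ≤ (2 * M ^ 3 * (Q * p) + M ^ 2 * p) / (M ^ 2 * p) ^ 2 := by gcongr
    _ = _ := by field_simp; ring

end SecondMoment

/-! ### The tilted law of a matched pair -/

section Weights

lemma exists_probabilityMeasure_of_weights {C : Type*} [Fintype C] [MeasurableSpace C]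
    [MeasurableSingletonClass C] {w : C → ℝ} (hw : ∀ c, 0 ≤ w c) (h1 : ∑ c, w c = 1) :
    ∃ α : Measure C, IsProbabilityMeasure α ∧ ∀ c, α.real {c} = w c := by
  classical
  have hval : ∀ c, (∑ d, ENNReal.ofReal (w d) • Measure.dirac d : Measure C) {c} =
      ENNReal.ofReal (w c) := by
    intro c
    simp [Measure.finsetSum_apply, Set.indicator_apply, Finset.sum_ite_eq']
  refine ⟨∑ d, ENNReal.ofReal (w d) • Measure.dirac d, ⟨?_⟩, fun c => ?_⟩
  · simp only [Measure.finsetSum_apply, Measure.smul_apply, measure_univ, smul_eq_mul, mul_one]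
    rw [← ENNReal.ofReal_sum_of_nonneg fun d _ => hw d, h1, ENNReal.ofReal_one]
  · rw [measureReal_def, hval, ENNReal.toReal_ofReal (hw c)]

/-- Chebyshev's inequality for sums over a product measure. -/
lemma measureReal_pi_abs_sub_ge_le {C : Type*} [Finite C] [MeasurableSpace C]
    [MeasurableSingletonClass C] (α : Measure C) [IsProbabilityMeasure α] (f : C → ℝ) {ε : ℝ}
    (hε : 0 < ε) {ℓ : ℕ} (hℓ : 0 < ℓ) :
    (Measure.pi fun _ : Fin ℓ => α).real {c | ε * ℓ ≤ |∑ s, f (c s) - ℓ * ∫ x, f x ∂α|} ≤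
      Var[f; α] / (ε ^ 2 * ℓ) := by
  have hL : ∀ _ : Fin ℓ, MemLp f 2 α := fun _ => .of_discrete
  have hsum : (∑ s : Fin ℓ, fun c : Fin ℓ → C => f (c s)) = fun c => ∑ s, f (c s) := by
    ext c; simp
  have hvar := variance_sum_pi (μ := fun _ : Fin ℓ => α) (X := fun _ => f) hL
  have hmean : ∫ c, ∑ s, f (c s) ∂(Measure.pi fun _ : Fin ℓ => α) = ℓ * ∫ x, f x ∂α := by
    rw [integral_finsetSum _ fun s _ => .of_finite]
    simp [integral_comp_eval (μ := fun _ : Fin ℓ => α)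
      (Measurable.of_discrete (f := f)).aestronglyMeasurable]
  rw [hsum] at hvar
  have hℓ' : (0 : ℝ) < ℓ := by exact_mod_cast hℓ
  have hpos : 0 < ε * ℓ := by positivity
  have h := meas_ge_le_variance_div_sq (μ := Measure.pi fun _ : Fin ℓ => α)
    (X := fun c => ∑ s, f (c s)) .of_discrete hpos
  rw [hmean, hvar] at h
  refine (ENNReal.toReal_le_of_le_ofReal (div_nonneg (Finset.sum_nonneg fun _ _ =>
    variance_nonneg _ _) (sq_nonneg _)) h).trans (le_of_eq ?_)
  simp only [Finset.sum_const, Finset.card_univ, Fintype.card_fin, nsmul_eq_mul]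
  field_simp

lemma measureReal_pi_singleton {C : Type*} [MeasurableSpace C] (α : Measure C)
    [IsProbabilityMeasure α] {ℓ : ℕ} (c : Fin ℓ → C) :
    (Measure.pi fun _ : Fin ℓ => α).real {c} = ∏ s, α.real {c s} := by
  simp [measureReal_def, Measure.pi_singleton, ENNReal.toReal_prod]

end Weights

section Tilted

variable {A : Type*} [MeasurableSpace A] (μ : Measure A) (K : A → A → ℝ) (θ : ℝ)

/-- The weight of a matched pair under the law `μ ⊗ μ` exponentially tilted by `θ K`. -/
noncomputable def tiltedWeight (a b : A) : ℝ := μ.real {a} * μ.real {b} * Real.exp (θ * K a b)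

variable {μ K θ}

lemma tiltedWeight_pos (hμ : ∀ a, 0 < μ.real {a}) (a b : A) : 0 < tiltedWeight μ K θ a b := by
  have := hμ a; have := hμ b; unfold tiltedWeight; positivity

lemma tiltedWeight_symm (hK : ∀ a b, K a b = K b a) (a b : A) :
    tiltedWeight μ K θ a b = tiltedWeight μ K θ b a := by
  unfold tiltedWeight; rw [hK a b]; ring

variable (μ K θ) [Fintype A]

/-- The density of the first marginal of the tilted law with respect to `μ`. -/
noncomputable def tiltedDensity (a : A) : ℝ := ∑ b, μ.real {b} * Real.exp (θ * K a b)

/-- The mean similarity of a matched pair under the tilted law. -/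
noncomputable def tiltedMean : ℝ := ∑ a, ∑ b, tiltedWeight μ K θ a b * K a b

/-- The relative entropy with respect to `μ` of the marginal of the tilted law. -/
noncomputable def marginalEntropy : ℝ :=
  ∑ a, ∑ b, tiltedWeight μ K θ a b * Real.log (tiltedDensity μ K θ a)

variable {μ K θ}

lemma tiltedDensity_pos (hμ : ∀ a, 0 < μ.real {a}) (a : A) : 0 < tiltedDensity μ K θ a :=
  Finset.sum_pos (fun b _ => mul_pos (hμ b) (Real.exp_pos _)) ⟨a, Finset.mem_univ a⟩

/-- `θ` times the mean is the relative entropy of the tilted law, which is positive because `K` is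
not identically zero. -/
lemma tiltedMean_pos [MeasurableSingletonClass A] [IsProbabilityMeasure μ]
    (hμ : ∀ a, 0 < μ.real {a}) (hθ : 0 < θ) (hKpos : ∃ a b, 0 < K a b)
    (hroot : ∑ a, ∑ b, tiltedWeight μ K θ a b = 1) : 0 < tiltedMean μ K θ := by
  -- pointwise `t * log t ≥ t - 1` for `t = exp (θ * K a b)`, strictly unless `K a b = 0`
  have conv : ∀ x : ℝ, 0 ≤ Real.exp x * x - Real.exp x + 1 := fun x => by
    have h1 := Real.add_one_le_exp (-x)
    have h2 : Real.exp x * Real.exp (-x) = 1 := by rw [← Real.exp_add]; simp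
    nlinarith [Real.exp_pos x]
  have conv' : ∀ x : ℝ, x ≠ 0 → 0 < Real.exp x * x - Real.exp x + 1 := fun x hx => by
    have h1 := Real.add_one_lt_exp (neg_ne_zero.2 hx)
    have h2 : Real.exp x * Real.exp (-x) = 1 := by rw [← Real.exp_add]; simp
    nlinarith [Real.exp_pos x]
  obtain ⟨a, b, hab⟩ := hKpos
  have hpos := sum_sum_pos_of_pos hμ
    (F := fun a b => Real.exp (θ * K a b) * (θ * K a b) - Real.exp (θ * K a b) + 1)
    (fun a b => conv _) ⟨a, b, conv' _ (mul_pos hθ hab).ne'⟩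
  have e : ∑ a, ∑ b, μ.real {a} * μ.real {b} *
      (Real.exp (θ * K a b) * (θ * K a b) - Real.exp (θ * K a b) + 1) =
      θ * tiltedMean μ K θ - (∑ a, ∑ b, tiltedWeight μ K θ a b)
        + ∑ a, ∑ b, μ.real {a} * μ.real {b} := by
    unfold tiltedMean tiltedWeight
    simp only [Finset.mul_sum, ← Finset.sum_add_distrib, ← Finset.sum_sub_distrib]
    exact Finset.sum_congr rfl fun a _ => Finset.sum_congr rfl fun b _ => by ring
  rw [e, hroot, sum_sum_measureReal_eq_one] at hpos
  nlinarith

/-- By symmetry of `K` both marginals of the tilted law have the same entropy, and the entropy of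
a joint law is at least the sum of the entropies of its marginals. -/
lemma two_mul_marginalEntropy_le (hμ : ∀ a, 0 < μ.real {a}) (hK : ∀ a b, K a b = K b a)
    (hroot : ∑ a, ∑ b, tiltedWeight μ K θ a b = 1) :
    2 * marginalEntropy μ K θ ≤ θ * tiltedMean μ K θ := by
  set f := tiltedDensity μ K θ with hf
  have hfpos : ∀ a, 0 < f a := tiltedDensity_pos hμ
  have hswap : marginalEntropy μ K θ = ∑ a, ∑ b, tiltedWeight μ K θ a b * Real.log (f b) := by
    unfold marginalEntropy
    rw [Finset.sum_comm]
    exact Finset.sum_congr rfl fun a _ => Finset.sum_congr rfl fun b _ => by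
      rw [tiltedWeight_symm hK]
  have hmass : ∑ a, μ.real {a} * f a = 1 := by
    rw [← hroot]
    simp only [hf, tiltedDensity, tiltedWeight, Finset.mul_sum, mul_assoc]
  -- Gibbs' inequality: `log t ≤ t - 1` for the ratio of the product of marginals to the joint law
  have key : ∀ a b, tiltedWeight μ K θ a b *
      (Real.log (f a) + Real.log (f b) - θ * K a b) ≤
      (μ.real {a} * f a) * (μ.real {b} * f b) - tiltedWeight μ K θ a b := by
    intro a b
    have h1 := Real.log_le_sub_one_of_pos (x := f a * f b * Real.exp (-(θ * K a b)))
      (mul_pos (mul_pos (hfpos a) (hfpos b)) (Real.exp_pos _))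
    rw [Real.log_mul (mul_pos (hfpos a) (hfpos b)).ne' (Real.exp_pos _).ne',
      Real.log_mul (hfpos a).ne' (hfpos b).ne', Real.log_exp] at h1
    have h2 := mul_le_mul_of_nonneg_left h1 (tiltedWeight_pos (K := K) (θ := θ) hμ a b).le
    have h3 : tiltedWeight μ K θ a b * (f a * f b * Real.exp (-(θ * K a b))) =
        (μ.real {a} * f a) * (μ.real {b} * f b) := by
      have : Real.exp (θ * K a b) * Real.exp (-(θ * K a b)) = 1 := by rw [← Real.exp_add]; simp
      unfold tiltedWeight
      linear_combination (μ.real {a} * f a) * (μ.real {b} * f b) * this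
    linarith
  have hsum := Finset.sum_le_sum fun a (_ : a ∈ Finset.univ) =>
    Finset.sum_le_sum fun b (_ : b ∈ Finset.univ) => key a b
  have e1 : ∑ a, ∑ b, tiltedWeight μ K θ a b *
      (Real.log (f a) + Real.log (f b) - θ * K a b) =
      2 * marginalEntropy μ K θ - θ * tiltedMean μ K θ := by
    rw [two_mul]
    nth_rw 2 [hswap]
    unfold marginalEntropy tiltedMean
    simp only [Finset.mul_sum, ← Finset.sum_add_distrib, ← Finset.sum_sub_distrib]
    exact Finset.sum_congr rfl fun a _ => Finset.sum_congr rfl fun b _ => by ring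
  have e2 : ∑ a, ∑ b, ((μ.real {a} * f a) * (μ.real {b} * f b) - tiltedWeight μ K θ a b) = 0 := by
    simp only [Finset.sum_sub_distrib]
    rw [← Finset.sum_mul_sum, hmass, hroot]
    ring
  linarith

/-! ### Typical pairs of words -/

/-- The pairs of words of length `ℓ` whose ungapped score and whose marginal likelihood ratios are
typical, up to `ε ℓ`, for independent matched pairs with the tilted law. -/
def TypicalPair (μ : Measure A) (K : A → A → ℝ) (θ ε : ℝ) {ℓ : ℕ} (x y : Fin ℓ → A) : Prop :=
  |∑ s, K (x s) (y s) - ℓ * tiltedMean μ K θ| < ε * ℓ ∧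
    ∑ s, Real.log (tiltedDensity μ K θ (x s)) ≤ ℓ * (marginalEntropy μ K θ + ε) ∧
    ∑ s, Real.log (tiltedDensity μ K θ (y s)) ≤ ℓ * (marginalEntropy μ K θ + ε)

lemma TypicalPair.symm (hK : ∀ a b, K a b = K b a) {ε : ℝ} {ℓ : ℕ} {x y : Fin ℓ → A}
    (h : TypicalPair μ K θ ε x y) : TypicalPair μ K θ ε y x :=
  ⟨by simpa only [hK] using h.1, h.2.2, h.2.1⟩

variable [MeasurableSingletonClass A]

open Classical in
/-- A fixed word has few typical partners: the tilting factor is bounded on typical pairs, and the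
tilted mass of all partners of `x` is the likelihood ratio of `x`. -/
lemma integral_typicalPair_right_le [IsProbabilityMeasure μ] (hμ : ∀ a, 0 < μ.real {a})
    (hθ : 0 < θ) {ε : ℝ} {ℓ : ℕ} (x : Fin ℓ → A) :
    ∫ y, (if TypicalPair μ K θ ε x y then (1 : ℝ) else 0) ∂(Measure.pi fun _ : Fin ℓ => μ) ≤
      Real.exp ((marginalEntropy μ K θ + ε - θ * (tiltedMean μ K θ - ε)) * ℓ) := by
  by_cases hx : ∑ s, Real.log (tiltedDensity μ K θ (x s)) ≤ ℓ * (marginalEntropy μ K θ + ε)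
  swap
  · have : ∀ y, ¬ TypicalPair μ K θ ε x y := fun y h => hx h.2.1
    simp only [this, if_false, integral_zero]
    positivity
  have hpt : ∀ y : Fin ℓ → A, (if TypicalPair μ K θ ε x y then (1 : ℝ) else 0) ≤
      Real.exp (-(θ * (tiltedMean μ K θ - ε) * ℓ)) * ∏ s, Real.exp (θ * K (x s) (y s)) := by
    intro y
    split_ifs with h
    · rw [← Real.exp_sum, ← Real.exp_add, ← Finset.mul_sum]
      refine Real.one_le_exp ?_
      have h1 := (abs_lt.1 h.1).1
      nlinarith
    · exact mul_nonneg (Real.exp_pos _).le (Finset.prod_nonneg fun s _ => (Real.exp_pos _).le)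
  calc _ ≤ ∫ y, Real.exp (-(θ * (tiltedMean μ K θ - ε) * ℓ)) * ∏ s, Real.exp (θ * K (x s) (y s))
        ∂(Measure.pi fun _ : Fin ℓ => μ) := integral_mono .of_finite .of_finite hpt
    _ = Real.exp (-(θ * (tiltedMean μ K θ - ε) * ℓ)) * ∏ s, tiltedDensity μ K θ (x s) := by
        rw [integral_const_mul, integral_fintype_prod_eq_prod
          (f := fun s b => Real.exp (θ * K (x s) b))]
        congr 1
        refine Finset.prod_congr rfl fun s _ => ?_
        rw [integral_fintype .of_finite]
        rfl
    _ = Real.exp (-(θ * (tiltedMean μ K θ - ε) * ℓ)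
          + ∑ s, Real.log (tiltedDensity μ K θ (x s))) := by
        rw [Real.exp_add, Real.exp_sum]
        simp only [Real.exp_log (tiltedDensity_pos hμ _)]
    _ ≤ _ := Real.exp_le_exp.2 (by linarith)

/-- The law of large numbers under the tilted law makes typical pairs typical. -/
lemma exists_half_le_measureReal_pi_typicalPair (hK : ∀ a b, K a b = K b a) {ε : ℝ} (hε : 0 < ε)
    (α : Measure (A × A)) [IsProbabilityMeasure α]
    (hα : ∀ c, α.real {c} = tiltedWeight μ K θ c.1 c.2) :
    ∃ ℓ₀ : ℕ, ∀ ℓ ≥ ℓ₀, 1 / 2 ≤ (Measure.pi fun _ : Fin ℓ => α).real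
      {c | TypicalPair μ K θ ε (fun s => (c s).1) (fun s => (c s).2)} := by
  let f₁ : A × A → ℝ := fun c => K c.1 c.2
  let f₂ : A × A → ℝ := fun c => Real.log (tiltedDensity μ K θ c.1)
  let f₃ : A × A → ℝ := fun c => Real.log (tiltedDensity μ K θ c.2)
  have int : ∀ f : A × A → ℝ, ∫ c, f c ∂α = ∑ a, ∑ b, tiltedWeight μ K θ a b * f (a, b) := by
    intro f
    rw [integral_fintype .of_finite, Fintype.sum_prod_type]
    simp only [hα, smul_eq_mul]
  have m₁ : ∫ c, f₁ c ∂α = tiltedMean μ K θ := int f₁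
  have m₂ : ∫ c, f₂ c ∂α = marginalEntropy μ K θ := int f₂
  have m₃ : ∫ c, f₃ c ∂α = marginalEntropy μ K θ := by
    rw [int f₃, marginalEntropy, Finset.sum_comm]
    exact Finset.sum_congr rfl fun a _ => Finset.sum_congr rfl fun b _ => by
      rw [tiltedWeight_symm hK]
  set V := Var[f₁; α] + Var[f₂; α] + Var[f₃; α] with hV
  obtain ⟨ℓ₀, hℓ₀⟩ := exists_nat_gt (2 * V / ε ^ 2)
  refine ⟨ℓ₀ + 1, fun ℓ hℓ => ?_⟩
  have hℓ0 : 0 < ℓ := by omega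
  have hℓ' : (0 : ℝ) < ℓ := by exact_mod_cast hℓ0
  set π := Measure.pi fun _ : Fin ℓ => α
  let B : (A × A → ℝ) → Set (Fin ℓ → A × A) := fun f =>
    {c | ε * ℓ ≤ |∑ s, f (c s) - ℓ * ∫ x, f x ∂α|}
  have hB : ∀ f, π.real (B f) ≤ Var[f; α] / (ε ^ 2 * ℓ) := fun f =>
    measureReal_pi_abs_sub_ge_le α f hε hℓ0
  have hcover : (Set.univ : Set (Fin ℓ → A × A)) ⊆
      {c | TypicalPair μ K θ ε (fun s => (c s).1) (fun s => (c s).2)} ∪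
        (B f₁ ∪ (B f₂ ∪ B f₃)) := by
    intro c _
    by_contra hc
    simp only [Set.mem_union, not_or] at hc
    obtain ⟨h0, h1, h2, h3⟩ := hc
    refine h0 ⟨?_, ?_, ?_⟩
    · simpa [B, m₁, f₁] using h1
    · have := (abs_lt.1 (not_le.1 (show ¬ ε * ℓ ≤ |∑ s, f₂ (c s) - ℓ * ∫ x, f₂ x ∂α| from h2))).2
      rw [m₂] at this
      have e : ∑ s, f₂ (c s) = ∑ s, Real.log (tiltedDensity μ K θ (c s).1) := rfl
      linarith
    · have := (abs_lt.1 (not_le.1 (show ¬ ε * ℓ ≤ |∑ s, f₃ (c s) - ℓ * ∫ x, f₃ x ∂α| from h3))).2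
      rw [m₃] at this
      have e : ∑ s, f₃ (c s) = ∑ s, Real.log (tiltedDensity μ K θ (c s).2) := rfl
      linarith
  have h1 : (1 : ℝ) ≤ π.real {c | TypicalPair μ K θ ε (fun s => (c s).1) (fun s => (c s).2)} +
      (π.real (B f₁) + (π.real (B f₂) + π.real (B f₃))) := by
    calc (1 : ℝ) = π.real Set.univ := by simp
      _ ≤ _ := measureReal_mono hcover
      _ ≤ _ := (measureReal_union_le _ _).trans (by
          gcongr
          exact (measureReal_union_le _ _).trans (by gcongr; exact measureReal_union_le _ _))
  have h2 : V / (ε ^ 2 * ℓ) ≤ 1 / 2 := by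
    rw [div_le_iff₀ (by positivity)]
    have : 2 * V / ε ^ 2 ≤ ℓ := hℓ₀.le.trans (by exact_mod_cast (by omega : ℓ₀ ≤ ℓ))
    rw [div_le_iff₀ (by positivity)] at this
    linarith
  have h3 : V / (ε ^ 2 * ℓ) = Var[f₁; α] / (ε ^ 2 * ℓ) + (Var[f₂; α] / (ε ^ 2 * ℓ)
      + Var[f₃; α] / (ε ^ 2 * ℓ)) := by rw [hV]; ring
  linarith [hB f₁, hB f₂, hB f₃]

open Classical in
/-- A change of measure bounds the untilted probability of a typical pair from below. -/
lemma exists_le_integral_typicalPair [IsProbabilityMeasure μ] (hμ : ∀ a, 0 < μ.real {a})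
    (hK : ∀ a b, K a b = K b a) (hθ : 0 < θ) (hroot : ∑ a, ∑ b, tiltedWeight μ K θ a b = 1) {ε : ℝ} (hε : 0 < ε) :
    ∃ ℓ₀ : ℕ, ∀ ℓ ≥ ℓ₀, Real.exp (-(θ * (tiltedMean μ K θ + ε)) * ℓ) / 2 ≤
      ∫ x, ∫ y, (if TypicalPair μ K θ ε x y then (1 : ℝ) else 0)
        ∂(Measure.pi fun _ : Fin ℓ => μ) ∂(Measure.pi fun _ : Fin ℓ => μ) := by
  obtain ⟨α, hα1, hα⟩ := exists_probabilityMeasure_of_weights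
    (w := fun c : A × A => tiltedWeight μ K θ c.1 c.2) (fun c => (tiltedWeight_pos hμ _ _).le)
    (by rw [Fintype.sum_prod_type]; exact hroot)
  obtain ⟨ℓ₀, hℓ₀⟩ := exists_half_le_measureReal_pi_typicalPair hK hε α hα
  refine ⟨ℓ₀, fun ℓ hℓ => ?_⟩
  have h1 := hℓ₀ ℓ hℓ
  have e1 : (Measure.pi fun _ : Fin ℓ => α).real
      {c | TypicalPair μ K θ ε (fun s => (c s).1) (fun s => (c s).2)} =
      ∑ x : Fin ℓ → A, ∑ y : Fin ℓ → A, (∏ s, μ.real {x s}) * (∏ s, μ.real {y s}) *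
        (Real.exp (θ * ∑ s, K (x s) (y s)) * if TypicalPair μ K θ ε x y then 1 else 0) := by
    rw [← integral_indicator_one (Set.toFinite _).measurableSet, integral_fintype .of_finite,
      ← Fintype.sum_prod_type', ← (Equiv.arrowProdEquivProdArrow (Fin ℓ) _ _).sum_comp]
    refine Finset.sum_congr rfl fun c _ => ?_
    rw [measureReal_pi_singleton]
    simp only [hα, tiltedWeight, Equiv.arrowProdEquivProdArrow_apply, Finset.mul_sum,
      Real.exp_sum, Finset.prod_mul_distrib, smul_eq_mul, Set.indicator_apply, Set.mem_ofPred_eq,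
      Pi.one_apply]
    ring
  have e2 : ∫ x, ∫ y, (if TypicalPair μ K θ ε x y then (1 : ℝ) else 0)
        ∂(Measure.pi fun _ : Fin ℓ => μ) ∂(Measure.pi fun _ : Fin ℓ => μ) =
      ∑ x : Fin ℓ → A, ∑ y : Fin ℓ → A, (∏ s, μ.real {x s}) * (∏ s, μ.real {y s}) *
        if TypicalPair μ K θ ε x y then 1 else 0 := by
    rw [integral_fintype .of_finite]
    refine Finset.sum_congr rfl fun x _ => ?_
    rw [integral_fintype .of_finite, smul_eq_mul, Finset.mul_sum]
    refine Finset.sum_congr rfl fun y _ => ?_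
    rw [measureReal_pi_singleton, measureReal_pi_singleton, smul_eq_mul, mul_assoc]
  have hw : ∀ x : Fin ℓ → A, 0 ≤ ∏ s, μ.real {x s} := fun x =>
    Finset.prod_nonneg fun s _ => (hμ _).le
  rw [e2]
  calc Real.exp (-(θ * (tiltedMean μ K θ + ε)) * ℓ) / 2
      = Real.exp (-(θ * (tiltedMean μ K θ + ε)) * ℓ) * (1 / 2) := by ring
    _ ≤ Real.exp (-(θ * (tiltedMean μ K θ + ε)) * ℓ) * _ :=
        mul_le_mul_of_nonneg_left (h1.trans_eq e1) (Real.exp_pos _).le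
    _ ≤ _ := by
        simp only [Finset.mul_sum]
        refine Finset.sum_le_sum fun x _ => Finset.sum_le_sum fun y _ => ?_
        split_ifs with h
        · rw [mul_left_comm]
          refine mul_le_mul_of_nonneg_left ?_ (mul_nonneg (hw x) (hw y))
          rw [mul_one, ← Real.exp_add, Real.exp_le_one_iff, ← Finset.mul_sum]
          have h1 := (abs_lt.1 h.1).2
          nlinarith
        · simp

end Tilted

/-! ### The ungapped lower bound for the local score -/

section LowerBound

variable {Ω A : Type*} [MeasurableSpace Ω] [Fintype A] [MeasurableSpace A]
  [MeasurableSingletonClass A] {P : Measure Ω} [IsProbabilityMeasure P] {μ : Measure A}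
  [IsProbabilityMeasure μ] {Z : ℕ ⊕ ℕ → Ω → A} {K : A → A → ℝ} {g : ℕ → ℝ} {θ C : ℝ}

/-- The second moment bound applied to typical pairs among `M` consecutive blocks of length `ℓ`. -/
lemma exists_measureReal_localScore_lt_le (hZ : iIndepFun Z P) (hm : ∀ i, Measurable (Z i))
    (hlaw : ∀ i, P.map (Z i) = μ) (hμ : ∀ a, 0 < μ.real {a}) (hK : ∀ a b, K a b = K b a)
    (hθ : 0 < θ) (hroot : ∑ a, ∑ b, tiltedWeight μ K θ a b = 1)
    (hC : 0 ≤ C) (hKC : ∀ a b, |K a b| ≤ C) (hg0 : g 0 = 0) (hg : ∀ k, 0 ≤ g k)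
    {ε : ℝ} (hε : 0 < ε) :
    ∃ ℓ₀ : ℕ, ∀ ℓ > ℓ₀, ∀ M > 0, ∀ n, ℓ * M ≤ n →
      P.real {ω | localScore K g (randomWord (fun i => Z (.inl i)) n ω)
        (randomWord (fun i => Z (.inr i)) n ω) < (tiltedMean μ K θ - ε) * ℓ} ≤
      2 * (Real.exp ((θ * tiltedMean μ K θ / 2 + (2 * θ + 1) * ε) * ℓ) / M) ^ 2 +
        4 * (Real.exp ((θ * tiltedMean μ K θ / 2 + (2 * θ + 1) * ε) * ℓ) / M) := by
  classical
  obtain ⟨ℓ₀, hℓ₀⟩ := exists_le_integral_typicalPair hμ hK hθ hroot hε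
  refine ⟨ℓ₀, fun ℓ hℓ M hM n hn => ?_⟩
  have hp := hℓ₀ ℓ hℓ.le
  set κ := tiltedMean μ K θ
  set h := marginalEntropy μ K θ
  have hent : 2 * h ≤ θ * κ := two_mul_marginalEntropy_le hμ hK hroot
  set ν : Measure (Fin ℓ → A) := Measure.pi fun _ => μ with hν
  set p := ∫ x, ∫ y, (if TypicalPair μ K θ ε x y then (1 : ℝ) else 0) ∂ν ∂ν with hpdef
  have hp0 : 0 < p := lt_of_lt_of_le (by positivity) hp
  let f : (ℕ ⊕ ℕ) × Fin ℓ → ℕ ⊕ ℕ := fun r =>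
    Sum.map (fun i => ℓ * i + r.2) (fun i => ℓ * i + r.2) r.1
  have hinj : ∀ {i j : ℕ} {s s' : Fin ℓ}, ℓ * i + s = ℓ * j + s' → i = j ∧ s = s' := by
    intro i j s s' e
    have hs := s.2
    have hs' := s'.2
    have hij : i = j := by
      have h1 := congrArg (· / ℓ) e
      simpa [Nat.mul_add_div (Nat.pos_of_ne_zero (by omega) : 0 < ℓ), Nat.div_eq_of_lt hs,
        Nat.div_eq_of_lt hs'] using h1
    subst hij
    exact ⟨rfl, Fin.ext (by omega)⟩
  have hf : f.Injective := by
    rintro ⟨i | i, s⟩ ⟨j | j, s'⟩ e <;> simp [f] at e ⊢ <;> exact hinj e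
  let W : ℕ ⊕ ℕ → Ω → (Fin ℓ → A) := fun i ω s => Z (f (i, s)) ω
  have hW : iIndepFun W P := iIndepFun_group hZ hm hf
  have hWm : ∀ i, Measurable (W i) := fun i => measurable_pi_lambda _ fun s => hm _
  have hWlaw : ∀ i, P.map (W i) = ν := fun i =>
    map_group_eq_pi hZ hm hlaw (f := fun s => f (i, s)) fun a b e => (Prod.ext_iff.1 (hf e)).2
  set Q := Real.exp ((h + ε - θ * (κ - ε)) * ℓ) with hQ
  have hQ₁ : ∀ x, ∫ y, (if TypicalPair μ K θ ε x y then (1 : ℝ) else 0) ∂ν ≤ Q := fun x =>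
    integral_typicalPair_right_le hμ hθ x
  have hQ₂ : ∀ y, ∫ x, (if TypicalPair μ K θ ε x y then (1 : ℝ) else 0) ∂ν ≤ Q := by
    intro y
    have : ∀ x, TypicalPair μ K θ ε x y ↔ TypicalPair μ K θ ε y x := fun x =>
      ⟨fun h => h.symm hK, fun h => h.symm hK⟩
    simpa only [this] using hQ₁ y
  have hmain := measureReal_forall_not_rel_le hW hWm hWlaw (TypicalPair μ K θ ε) hQ₁ hQ₂ rfl hp0 hM
  have hsub : {ω | localScore K g (randomWord (fun i => Z (.inl i)) n ω)
        (randomWord (fun i => Z (.inr i)) n ω) < (κ - ε) * ℓ} ⊆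
      {ω | ∀ i < M, ∀ j < M, ¬ TypicalPair μ K θ ε (W (.inl i) ω) (W (.inr j) ω)} := by
    intro ω hω i hi j hj htyp
    have fit : ∀ i < M, ℓ * i + ℓ ≤ n := fun i hi =>
      le_trans (by nlinarith : ℓ * i + ℓ ≤ ℓ * M) hn
    have h1 := sum_diagonal_le_localScore hg0 hC hKC hg (fun t => Z (.inl t) ω)
      (fun t => Z (.inr t) ω) (by omega : ℓ ≠ 0) (fit i hi) (fit j hj)
    have h2 := (abs_lt.1 htyp.1).1
    have h3 : ∑ s, K (W (.inl i) ω s) (W (.inr j) ω s) =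
        ∑ s : Fin ℓ, K (Z (.inl (ℓ * i + s)) ω) (Z (.inr (ℓ * j + s)) ω) := rfl
    rw [h3] at h2
    have h4 : localScore K g (randomWord (fun i => Z (.inl i)) n ω)
        (randomWord (fun i => Z (.inr i)) n ω) < (κ - ε) * ℓ := hω
    have h5 : ∑ s : Fin ℓ, K (Z (.inl (ℓ * i + s)) ω) (Z (.inr (ℓ * j + s)) ω) ≤
      localScore K g (randomWord (fun i => Z (.inl i)) n ω)
        (randomWord (fun i => Z (.inr i)) n ω) := h1
    linarith
  have hM' : (0 : ℝ) < M := by exact_mod_cast hM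
  have hℓ' : (0 : ℝ) ≤ ℓ := by positivity
  set r := θ * κ / 2 + (2 * θ + 1) * ε with hr
  have b0 : 1 / p ≤ 2 * Real.exp (θ * (κ + ε) * ℓ) := by
    rw [div_le_iff₀ hp0]
    have : Real.exp (θ * (κ + ε) * ℓ) * Real.exp (-(θ * (κ + ε)) * ℓ) = 1 := by
      rw [← Real.exp_add]; simp
    nlinarith [Real.exp_pos (θ * (κ + ε) * ℓ)]
  have b1 : Real.exp (θ * (κ + ε) * ℓ) ≤ Real.exp (r * ℓ) ^ 2 := by
    rw [← Real.exp_nat_mul]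
    refine Real.exp_le_exp.2 ?_
    push_cast
    rw [← mul_assoc]
    refine mul_le_mul_of_nonneg_right ?_ hℓ'
    rw [hr]; nlinarith [mul_pos hθ hε]
  have b2 : Q * Real.exp (θ * (κ + ε) * ℓ) ≤ Real.exp (r * ℓ) := by
    rw [hQ, ← Real.exp_add, ← add_mul]
    refine Real.exp_le_exp.2 (mul_le_mul_of_nonneg_right ?_ hℓ')
    rw [hr]; nlinarith
  have hQ0 : 0 ≤ Q := (Real.exp_pos _).le
  calc _ ≤ 1 / (M ^ 2 * p) + 2 * Q / (M * p) := (measureReal_mono hsub).trans hmain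
    _ = (1 / p) * (1 / M ^ 2) + 2 * (Q * (1 / p)) * (1 / M) := by field_simp
    _ ≤ (2 * Real.exp (r * ℓ) ^ 2) * (1 / M ^ 2) + 2 * (2 * Real.exp (r * ℓ)) * (1 / M) := by
        have c1 : 1 / p ≤ 2 * Real.exp (r * ℓ) ^ 2 := b0.trans (by linarith)
        have c2 : Q * (1 / p) ≤ 2 * Real.exp (r * ℓ) :=
          (mul_le_mul_of_nonneg_left b0 hQ0).trans (by linarith)
        gcongr
    _ = _ := by ring

/-- The local score is at least `s log n` with high probability, for every `s < 2 / θ`. -/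
lemma tendsto_measureReal_localScore_lt_mul_log (hZ : iIndepFun Z P) (hm : ∀ i, Measurable (Z i))
    (hlaw : ∀ i, P.map (Z i) = μ) (hμ : ∀ a, 0 < μ.real {a}) (hK : ∀ a b, K a b = K b a)
    (hKpos : ∃ a b, 0 < K a b) (hθ : 0 < θ)
    (hroot : ∑ a, ∑ b, tiltedWeight μ K θ a b = 1)
    (hC : 0 ≤ C) (hKC : ∀ a b, |K a b| ≤ C) (hg0 : g 0 = 0) (hg : ∀ k, 0 ≤ g k)
    {s : ℝ} (hs0 : 0 < s) (hs : s < 2 / θ) :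
    Tendsto (fun n : ℕ => P.real {ω | localScore K g (randomWord (fun i => Z (.inl i)) n ω)
        (randomWord (fun i => Z (.inr i)) n ω) < s * Real.log n}) atTop (𝓝 0) := by
  set κ := tiltedMean μ K θ with hκ
  have hκ0 : 0 < κ := tiltedMean_pos hμ hθ hKpos hroot
  have hsθ : θ * s / 2 < 1 := by rw [lt_div_iff₀ hθ] at hs; linarith
  -- `ε` is chosen such that `s * r < κ - ε` below
  set ε := κ * (1 - θ * s / 2) / (2 * (1 + (2 * θ + 1) * s)) with hε
  have hden : 0 < 1 + (2 * θ + 1) * s := by positivity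
  have hε0 : 0 < ε := div_pos (mul_pos hκ0 (by linarith)) (by positivity)
  have hε1 : ε * (1 + (2 * θ + 1) * s) < κ * (1 - θ * s / 2) := by
    have : ε * (1 + (2 * θ + 1) * s) = κ * (1 - θ * s / 2) / 2 := by rw [hε]; field_simp
    have h2 : 0 < κ * (1 - θ * s / 2) := mul_pos hκ0 (by linarith)
    linarith
  set r := θ * κ / 2 + (2 * θ + 1) * ε with hr
  have hr0 : 0 < r := by positivity
  have hsr : s * r < κ - ε := by rw [hr]; nlinarith
  have hκε : 0 < κ - ε := (mul_pos hs0 hr0).trans hsr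
  set ρ := s / (κ - ε) with hρ
  have hρ0 : 0 < ρ := div_pos hs0 hκε
  have hrρ : r * ρ < 1 := by rw [hρ, mul_div_assoc', div_lt_one hκε]; linarith
  obtain ⟨ℓ₀, hℓ₀⟩ := exists_measureReal_localScore_lt_le hZ hm hlaw hμ hK hθ hroot hC hKC hg0 hg hε0
  let ℓ : ℕ → ℕ := fun n => ⌈ρ * Real.log n⌉₊
  let M : ℕ → ℕ := fun n => n / ℓ n
  have hlog : Tendsto (fun n : ℕ => Real.log n) atTop atTop :=
    Real.tendsto_log_atTop.comp tendsto_natCast_atTop_atTop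
  have hℓlim : Tendsto ℓ atTop atTop :=
    tendsto_nat_ceil_atTop.comp (hlog.const_mul_atTop hρ0)
  have hlogo : Tendsto (fun n : ℕ => Real.log n / (n : ℝ) ^ (1 - r * ρ)) atTop (𝓝 0) :=
    (isLittleO_log_rpow_atTop (by linarith)).tendsto_div_nhds_zero.comp tendsto_natCast_atTop_atTop
  have hinvo : Tendsto (fun n : ℕ => 1 / (n : ℝ) ^ (1 - r * ρ)) atTop (𝓝 0) := by
    simp only [one_div]
    exact ((tendsto_rpow_atTop (by linarith)).comp tendsto_natCast_atTop_atTop).inv_tendsto_atTop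
  have hlogn : Tendsto (fun n : ℕ => Real.log n / n) atTop (𝓝 0) := by
    have := (Real.isLittleO_log_id_atTop).tendsto_div_nhds_zero.comp tendsto_natCast_atTop_atTop
    exact this
  have hone : Tendsto (fun n : ℕ => (1 : ℝ) / n) atTop (𝓝 0) := tendsto_one_div_atTop_nhds_zero_nat
  have hsmall : ∀ᶠ n : ℕ in atTop, 2 * ℓ n ≤ n := by
    have h1 : Tendsto (fun n : ℕ => 2 * (ρ * (Real.log n / n) + 1 / n)) atTop (𝓝 0) := by
      simpa using ((hlogn.const_mul ρ).add hone).const_mul 2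
    filter_upwards [h1.eventually (gt_mem_nhds zero_lt_one), eventually_gt_atTop 0,
      hlog.eventually_ge_atTop 0] with n hn hn0 hl
    have hn' : (0 : ℝ) < n := by exact_mod_cast hn0
    have h2 : (ℓ n : ℝ) ≤ ρ * Real.log n + 1 := (Nat.ceil_lt_add_one (by positivity)).le
    have h3 : 2 * (ρ * (Real.log n / n) + 1 / n) * n = 2 * (ρ * Real.log n + 1) := by field_simp
    have h4 : 2 * (ρ * (Real.log n / n) + 1 / n) * n < 1 * n := mul_lt_mul_of_pos_right hn hn'
    have : (2 * ℓ n : ℝ) ≤ n := by linarith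
    exact_mod_cast this
  have hbound : ∀ᶠ n : ℕ in atTop, Real.exp (r * ℓ n) / M n ≤
      2 * Real.exp r * (ρ * (Real.log n / (n : ℝ) ^ (1 - r * ρ))
        + 1 / (n : ℝ) ^ (1 - r * ρ)) := by
    filter_upwards [hsmall, eventually_gt_atTop 0, hℓlim.eventually_gt_atTop 0,
      hlog.eventually_ge_atTop 0] with n hn hn0 hℓn hl
    have hn' : (0 : ℝ) < n := by exact_mod_cast hn0
    have hℓn' : (0 : ℝ) < ℓ n := by exact_mod_cast hℓn
    have h2 : (ℓ n : ℝ) ≤ ρ * Real.log n + 1 := (Nat.ceil_lt_add_one (by positivity)).le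
    have hMn : (n : ℝ) / (2 * ℓ n) ≤ M n := by
      rw [div_le_iff₀ (by positivity)]
      have h5 : n < ℓ n * (M n + 1) := Nat.lt_mul_div_succ n hℓn
      have h6 : 0 < M n := Nat.div_pos (by omega) hℓn
      have h7 : n ≤ M n * (2 * ℓ n) := by nlinarith
      exact_mod_cast h7
    have h8 : Real.exp (r * ℓ n) ≤ Real.exp r * (n : ℝ) ^ (r * ρ) := by
      rw [Real.rpow_def_of_pos hn', ← Real.exp_add]
      refine Real.exp_le_exp.2 ?_
      nlinarith
    have h9 : (n : ℝ) ^ (r * ρ) = n / (n : ℝ) ^ (1 - r * ρ) := by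
      rw [Real.rpow_sub hn', Real.rpow_one]
      have := Real.rpow_pos_of_pos hn' (r * ρ)
      field_simp
    have hpos : 0 < (n : ℝ) ^ (1 - r * ρ) := Real.rpow_pos_of_pos hn' _
    calc Real.exp (r * ℓ n) / M n
        ≤ (Real.exp r * (n / (n : ℝ) ^ (1 - r * ρ))) / (n / (2 * ℓ n)) := by
          rw [← h9]; gcongr
      _ = 2 * Real.exp r * (ℓ n / (n : ℝ) ^ (1 - r * ρ)) := by field_simp
      _ ≤ 2 * Real.exp r * ((ρ * Real.log n + 1) / (n : ℝ) ^ (1 - r * ρ)) := by gcongr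
      _ = _ := by ring
  have hR : Tendsto (fun n : ℕ => Real.exp (r * ℓ n) / M n) atTop (𝓝 0) := by
    refine squeeze_zero' (Eventually.of_forall fun n => by positivity) hbound ?_
    simpa using ((hlogo.const_mul ρ).add hinvo).const_mul (2 * Real.exp r)
  have hfinal : Tendsto (fun n : ℕ => 2 * (Real.exp (r * ℓ n) / M n) ^ 2 +
      4 * (Real.exp (r * ℓ n) / M n)) atTop (𝓝 0) := by
    simpa using ((hR.pow 2).const_mul 2).add (hR.const_mul 4)
  refine squeeze_zero' (Eventually.of_forall fun n => measureReal_nonneg) ?_ hfinal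
  filter_upwards [hsmall, hℓlim.eventually_gt_atTop ℓ₀] with n hn hℓn
  refine le_trans (measureReal_mono fun ω hω => ?_)
    (hℓ₀ (ℓ n) hℓn (M n) (Nat.div_pos (by omega) (by omega)) n (Nat.mul_div_le n _))
  rw [Set.mem_ofPred_eq] at hω ⊢
  refine hω.trans_le ?_
  calc s * Real.log n = (κ - ε) * (ρ * Real.log n) := by rw [hρ]; field_simp
    _ ≤ (κ - ε) * ℓ n := mul_le_mul_of_nonneg_left (Nat.le_ceil _) hκε.le

end LowerBound

/-! ### Concave gap penalties -/

section GapPenalty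

variable {γ : ℕ → ℝ} {Δ : ℝ}

lemma gapPenalty_zero : gapPenalty Δ γ 0 = 0 := if_pos rfl

lemma gapPenalty_succ (k : ℕ) : gapPenalty Δ γ (k + 1) = Δ + γ (k + 1) := if_neg k.succ_ne_zero

lemma IsGapExtension.nonneg (hγ : IsGapExtension γ) (k : ℕ) : 0 ≤ γ (k + 1) := by
  induction k with
  | zero => simp [hγ.one]
  | succ k ih => exact ih.trans (hγ.mono (k + 1) (by omega))

lemma monotone_gapPenalty (hγ : IsGapExtension γ) (hΔ : 0 ≤ Δ) : Monotone (gapPenalty Δ γ) := by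
  refine monotone_nat_of_le_succ fun k => ?_
  rcases k with _ | k
  · rw [gapPenalty_zero, gapPenalty_succ]
    exact add_nonneg hΔ (hγ.nonneg 0)
  · rw [gapPenalty_succ, gapPenalty_succ]
    linarith [hγ.mono (k + 1) (by omega)]

lemma gapPenalty_nonneg (hγ : IsGapExtension γ) (hΔ : 0 ≤ Δ) (k : ℕ) : 0 ≤ gapPenalty Δ γ k := by
  simpa [gapPenalty_zero] using monotone_gapPenalty hγ hΔ k.zero_le

lemma IsGapExtension.antitone_div (hγ : IsGapExtension γ) :
    Antitone fun n : ℕ => γ (n + 2) / (n + 1) := by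
  have incr : ∀ n : ℕ, (n : ℝ) * (γ (n + 2) - γ (n + 1)) ≤ γ (n + 1) := by
    intro n
    induction n with
    | zero => simp [hγ.one]
    | succ n ih =>
      have h1 := hγ.concave (n + 1) (by omega)
      have h2 : (0 : ℝ) ≤ (n : ℝ) + 1 := by positivity
      push_cast
      have := mul_le_mul_of_nonneg_left h1 h2
      linarith
  refine antitone_nat_of_succ_le fun n => ?_
  have h := incr (n + 1)
  push_cast at h ⊢
  rw [div_le_div_iff₀ (by positivity) (by positivity)]
  linarith

/-- If `∑ exp (-θ' γ)` diverges, then `γ` drops below `log / θ₁` infinitely often, for every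
`θ₁ < θ'`. -/
lemma frequently_le_log_div {θ' θ₁ : ℝ} (h0 : 0 < θ₁) (h1 : θ₁ < θ')
    (hsum : ¬ Summable fun k : ℕ => Real.exp (-θ' * γ (k + 1))) :
    ∃ᶠ k : ℕ in atTop, γ k ≤ Real.log k / θ₁ := by
  intro hev
  refine hsum ?_
  have hev' : ∀ᶠ k : ℕ in atTop, Real.log (k + 1 : ℕ) / θ₁ < γ (k + 1) := by
    filter_upwards [(tendsto_add_atTop_nat 1).eventually hev] with k hk
    exact not_le.1 hk
  have hs : Summable fun k : ℕ => ((k + 1 : ℕ) : ℝ) ^ (-(θ' / θ₁)) :=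
    (summable_nat_add_iff 1).2 (Real.summable_nat_rpow.2
      (neg_lt_neg ((one_lt_div h0).2 h1)))
  refine Summable.of_norm_bounded_eventually_nat hs ?_
  filter_upwards [hev'] with k hk
  rw [Real.norm_of_nonneg (Real.exp_pos _).le, Real.rpow_def_of_pos (by positivity)]
  refine Real.exp_le_exp.2 ?_
  rw [div_lt_iff₀ h0] at hk
  have h2 : Real.log (k + 1 : ℕ) * -(θ' / θ₁) = -(Real.log (k + 1 : ℕ) / θ₁ * θ') := by ring
  have h3 : Real.log (k + 1 : ℕ) / θ₁ * θ' ≤ γ (k + 1) * θ' :=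
    mul_le_mul_of_nonneg_right ((div_le_iff₀ h0).2 hk.le) (h0.trans h1).le
  rw [h2]
  linarith

/-- A concave `γ` that is infinitely often at most logarithmic is sublinear. -/
lemma tendsto_gapPenalty_div (hγ : IsGapExtension γ) (hΔ : 0 ≤ Δ) {θ₁ : ℝ}
    (hfreq : ∃ᶠ k : ℕ in atTop, γ k ≤ Real.log k / θ₁) :
    Tendsto (fun n : ℕ => gapPenalty Δ γ n / n) atTop (𝓝 0) := by
  have hlogn : Tendsto (fun n : ℕ => Real.log n / n) atTop (𝓝 0) :=
    (Real.isLittleO_log_id_atTop).tendsto_div_nhds_zero.comp tendsto_natCast_atTop_atTop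
  have hanti : Tendsto (fun n : ℕ => γ (n + 2) / (n + 1)) atTop (𝓝 0) := by
    rw [tendsto_order]
    refine ⟨fun a ha => Eventually.of_forall fun n =>
      ha.trans_le (div_nonneg (hγ.nonneg (n + 1)) (by positivity)), fun a ha => ?_⟩
    have h1 : Tendsto (fun n : ℕ => 2 / θ₁ * (Real.log n / n)) atTop (𝓝 0) := by
      simpa using hlogn.const_mul (2 / θ₁)
    obtain ⟨k, hk, hka, hk2⟩ := (hfreq.and_eventually ((h1.eventually (gt_mem_nhds ha)).and
      (eventually_ge_atTop 2))).exists
    obtain ⟨m, rfl⟩ := Nat.exists_eq_add_of_le' hk2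
    have hm : γ (m + 2) / (m + 1) < a := by
      refine lt_of_le_of_lt ?_ hka
      have hlog : 0 ≤ γ (m + 2) := hγ.nonneg (m + 1)
      have hm2 : ((m + 2 : ℕ) : ℝ) ≤ 2 * (m + 1) := by push_cast; linarith
      have hpos : (0 : ℝ) < (m + 2 : ℕ) := by positivity
      calc γ (m + 2) / (m + 1) = 2 * γ (m + 2) / (2 * (m + 1)) := by
            rw [mul_div_mul_left _ _ two_ne_zero]
        _ ≤ 2 * γ (m + 2) / (m + 2 : ℕ) := by gcongr
        _ ≤ 2 * (Real.log (m + 2 : ℕ) / θ₁) / (m + 2 : ℕ) := by gcongr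
        _ = _ := by ring
    filter_upwards [eventually_ge_atTop m] with n hn
    exact (hγ.antitone_div hn).trans_lt hm
  have hbound : Tendsto (fun n : ℕ => Δ / (n + 2 : ℕ) + γ (n + 2) / (n + 1)) atTop (𝓝 0) := by
    have h2 : Tendsto (fun n : ℕ => Δ / ((n + 2 : ℕ) : ℝ)) atTop (𝓝 0) :=
      (tendsto_add_atTop_iff_nat (f := fun n : ℕ => Δ / (n : ℝ)) 2).2
        (tendsto_const_div_atTop_nhds_zero_nat Δ)
    simpa using h2.add hanti
  rw [← tendsto_add_atTop_iff_nat 2]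
  refine squeeze_zero (fun n => div_nonneg (gapPenalty_nonneg hγ hΔ _) (by positivity))
    (fun n => ?_) hbound
  rw [gapPenalty_succ, add_div]
  have := hγ.nonneg (n + 1)
  gcongr
  push_cast
  linarith

lemma isGapExtension_mul_log {δ : ℝ} (hδ : 0 < δ) : IsGapExtension fun k => δ * Real.log k where
  one := by simp
  mono k hk := by
    have : (0 : ℝ) < k := by exact_mod_cast hk
    gcongr
    simp
  concave k hk := by
    have hk' : (0 : ℝ) < k := by exact_mod_cast hk
    have h : Real.log (k + 2 : ℕ) + Real.log k ≤ 2 * Real.log (k + 1 : ℕ) := by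
      rw [← Real.log_mul (by positivity) hk'.ne', show (2 : ℝ) = (2 : ℕ) by norm_num,
        ← Real.log_pow]
      refine Real.log_le_log (by positivity) ?_
      push_cast
      nlinarith
    nlinarith

lemma summable_exp_mul_log_iff {δ θ' : ℝ} :
    (Summable fun k : ℕ => Real.exp (-θ' * (δ * Real.log (k + 1 : ℕ)))) ↔ 1 < θ' * δ := by
  have : ∀ k : ℕ, Real.exp (-θ' * (δ * Real.log (k + 1 : ℕ))) =
      ((k + 1 : ℕ) : ℝ) ^ (-(θ' * δ)) := fun k => by
    rw [Real.rpow_def_of_pos (by positivity)]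
    congr 1
    ring
  simp only [this]
  rw [summable_nat_add_iff 1 (f := fun k : ℕ => (k : ℝ) ^ (-(θ' * δ))), Real.summable_nat_rpow]
  exact neg_lt_neg_iff

end GapPenalty

/-! ### The growth rate of the local score -/

section Linear

variable {Ω A : Type*} [MeasurableSpace Ω] [Fintype A] [MeasurableSpace A]
  [MeasurableSingletonClass A] {P : Measure Ω} [IsProbabilityMeasure P] {μ : Measure A}
  {Z : ℕ ⊕ ℕ → Ω → A} {K : A → A → ℝ} {g : ℕ → ℝ} {C : ℝ}

lemma measurable_comp_randomWord (hm : ∀ i, Measurable (Z i)) {n : ℕ}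
    (Φ : (Fin n → A) → (Fin n → A) → ℝ) :
    Measurable fun ω => Φ (randomWord (fun i => Z (.inl i)) n ω)
      (randomWord (fun i => Z (.inr i)) n ω) :=
  (Measurable.of_discrete (f := fun w : (Fin n → A) × (Fin n → A) => Φ w.1 w.2)).comp
    ((measurable_randomWord (fun _ => hm _) n).prodMk (measurable_randomWord (fun _ => hm _) n))

lemma integrable_comp_randomWord (hm : ∀ i, Measurable (Z i)) {n : ℕ}
    (Φ : (Fin n → A) → (Fin n → A) → ℝ) :
    Integrable (fun ω => Φ (randomWord (fun i => Z (.inl i)) n ω)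
      (randomWord (fun i => Z (.inr i)) n ω)) P := by
  have h : Integrable (fun w : (Fin n → A) × (Fin n → A) => Φ w.1 w.2)
      (P.map fun ω => (randomWord (fun i => Z (.inl i)) n ω,
        randomWord (fun i => Z (.inr i)) n ω)) := .of_finite
  exact h.comp_measurable ((measurable_randomWord (fun i => hm _) n).prodMk
    (measurable_randomWord (fun i => hm _) n))

/-- The strong law of large numbers for a functional of consecutive windows of length `N`. -/
lemma ae_tendsto_average_windows (hZ : iIndepFun Z P) (hm : ∀ i, Measurable (Z i))
    (hlaw : ∀ i, P.map (Z i) = μ) {N : ℕ} (hN : 0 < N) (Φ : (Fin N → A) → (Fin N → A) → ℝ) :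
    ∀ᵐ ω ∂P, Tendsto (fun q : ℕ => (∑ k ∈ Finset.range q,
        Φ (fun s => Z (.inl (N * k + s)) ω) (fun s => Z (.inr (N * k + s)) ω)) / q) atTop
      (𝓝 (∫ ω, Φ (randomWord (fun i => Z (.inl i)) N ω)
        (randomWord (fun i => Z (.inr i)) N ω) ∂P)) := by
  let f : ℕ × (Fin N ⊕ Fin N) → ℕ ⊕ ℕ := fun r =>
    Sum.map (fun s : Fin N => N * r.1 + s) (fun s : Fin N => N * r.1 + s) r.2
  have hinj : ∀ {i j : ℕ} {s s' : Fin N}, N * i + s = N * j + s' → i = j ∧ s = s' := by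
    intro i j s s' e
    have hij : i = j := by
      have h1 := congrArg (· / N) e
      simpa [Nat.mul_add_div hN, Nat.div_eq_of_lt s.2, Nat.div_eq_of_lt s'.2] using h1
    subst hij
    exact ⟨rfl, Fin.ext (by omega)⟩
  have hf : f.Injective := by
    rintro ⟨i, s | s⟩ ⟨j, s' | s'⟩ e <;> simp [f] at e ⊢ <;> exact hinj e
  let W : ℕ → Ω → (Fin N ⊕ Fin N → A) := fun k ω s => Z (f (k, s)) ω
  have hWm : ∀ k, Measurable (W k) := fun k => measurable_pi_lambda _ fun s => hm _
  have hW : iIndepFun W P := iIndepFun_group hZ hm hf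
  have hWlaw : ∀ k, P.map (W k) = Measure.pi fun _ => μ := fun k =>
    map_group_eq_pi hZ hm hlaw (f := fun s => f (k, s)) fun a b e => (Prod.ext_iff.1 (hf e)).2
  let Ψ : (Fin N ⊕ Fin N → A) → ℝ := fun w => Φ (fun s => w (.inl s)) (fun s => w (.inr s))
  have hΨ : Measurable Ψ := .of_discrete
  have hident : ∀ k, IdentDistrib (fun ω => Ψ (W k ω)) (fun ω => Ψ (W 0 ω)) P P := fun k =>
    (IdentDistrib.mk (hWm k).aemeasurable (hWm 0).aemeasurable
      (by rw [hWlaw, hWlaw])).comp hΨ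
  have hzero : (fun ω => Ψ (W 0 ω)) = fun ω => Φ (randomWord (fun i => Z (.inl i)) N ω)
      (randomWord (fun i => Z (.inr i)) N ω) := by
    funext ω
    simp only [Ψ, W, f, Sum.map_inl, Sum.map_inr, mul_zero, zero_add]
    rfl
  have h := strong_law_ae_real (fun k ω => Ψ (W k ω))
    (by rw [hzero]; exact integrable_comp_randomWord hm Φ)
    (fun i j hij => (hW.indepFun hij).comp hΨ hΨ) hident
  simp only [hzero] at h
  exact h

/-- Gluing optimal alignments of consecutive windows of length `N` gives almost surely a linear
lower bound for the local score. -/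
lemma ae_eventually_lt_localScore_div (hZ : iIndepFun Z P) (hm : ∀ i, Measurable (Z i))
    (hlaw : ∀ i, P.map (Z i) = μ) (hC : 0 ≤ C) (hKC : ∀ a b, |K a b| ≤ C) (hg : ∀ k, 0 ≤ g k)
    (hmono : Monotone g) {N : ℕ} (hN : 0 < N) :
    ∀ᵐ ω ∂P, ∀ t < ((∫ ω, localScore K g (randomWord (fun i => Z (.inl i)) N ω)
        (randomWord (fun i => Z (.inr i)) N ω) ∂P) - 2 * g (2 * N)) / N,
      ∀ᶠ n : ℕ in atTop, t < localScore K g (randomWord (fun i => Z (.inl i)) n ω)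
        (randomWord (fun i => Z (.inr i)) n ω) / n := by
  filter_upwards [ae_tendsto_average_windows hZ hm hlaw hN (localScore K g)] with ω hω t ht
  have hN' : (0 : ℝ) < N := by exact_mod_cast hN
  have hdiv : Tendsto (fun n : ℕ => n / N) atTop atTop := Nat.tendsto_div_const_atTop hN.ne'
  have hfrac : Tendsto (fun n : ℕ => ((n / N : ℕ) : ℝ) / n) atTop (𝓝 (1 / N)) := by
    have h := (tendsto_nat_floor_mul_div_atTop (R := ℝ) (a := 1 / (N : ℝ))
      (by positivity)).comp tendsto_natCast_atTop_atTop
    refine h.congr fun n => ?_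
    simp only [Function.comp_apply]
    rw [← Nat.floor_div_eq_div (K := ℝ), one_div, inv_mul_eq_div]
  have hlim := ((hω.comp hdiv).sub_const (2 * g (2 * N))).mul hfrac
  rw [mul_one_div] at hlim
  filter_upwards [hlim.eventually (lt_mem_nhds ht), eventually_ge_atTop N] with n hn hnN
  refine hn.trans_le ?_
  have hn0 : (0 : ℝ) < n := by exact_mod_cast hN.trans_le hnN
  have hq : 0 < n / N := Nat.div_pos hnN hN
  have hq' : (0 : ℝ) < (n / N : ℕ) := by exact_mod_cast hq
  have h1 := sum_localScore_windows_le hC hKC hg hmono hN.ne' hq.ne' (Nat.mul_div_le n N)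
    (fun s => Z (.inl s) ω) (fun s => Z (.inr s) ω)
  simp only [Function.comp_apply]
  rw [mul_div_assoc', div_le_div_iff_of_pos_right hn0, sub_mul, div_mul_cancel₀ _ hq'.ne']
  refine le_trans (le_of_eq ?_) h1
  ring

/-- If the gap penalty is sublinear and gluing windows of some length `N` is profitable on
average, then the scores grow linearly. -/
lemma inLinearDomain_of_window (hZ : iIndepFun Z P) (hm : ∀ i, Measurable (Z i))
    (hlaw : ∀ i, P.map (Z i) = μ) (hC : 0 ≤ C) (hKC : ∀ a b, |K a b| ≤ C) (hg : ∀ k, 0 ≤ g k)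
    (hmono : Monotone g) (hsub : Tendsto (fun n : ℕ => g n / n) atTop (𝓝 0))
    {N : ℕ} (hN : 0 < N) (hpos : 2 * g (2 * N) <
      ∫ ω, localScore K g (randomWord (fun i => Z (.inl i)) N ω)
        (randomWord (fun i => Z (.inr i)) N ω) ∂P) :
    InLinearDomain P (fun i => Z (.inl i)) (fun i => Z (.inr i)) K g := by
  set H : ℕ → Ω → ℝ := fun n ω => localScore K g (randomWord (fun i => Z (.inl i)) n ω)
    (randomWord (fun i => Z (.inr i)) n ω) with hH
  set G : ℕ → Ω → ℝ := fun n ω => globalScore K g (randomWord (fun i => Z (.inl i)) n ω)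
    (randomWord (fun i => Z (.inr i)) n ω) with hG
  have hHi : ∀ n, Integrable (H n) P := fun n => integrable_comp_randomWord hm _
  have hGi : ∀ n, Integrable (G n) P := fun n => integrable_comp_randomWord hm _
  have hHb : ∀ n ω, |H n ω| ≤ n * C := fun n ω => abs_localScore_le hC hKC hg _ _
  have hZb : ∀ n ω, |H n ω / n| ≤ C := by
    intro n ω
    rw [abs_div, Nat.abs_cast]
    exact div_le_of_le_mul₀ n.cast_nonneg hC (by rw [mul_comm]; exact hHb n ω)
  let c : ℕ → ℝ := fun m => ((∫ ω, H (m + 1) ω ∂P) - 2 * g (2 * (m + 1))) / (m + 1 : ℕ)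
  have hcb : ∀ m, c m ≤ C := by
    intro m
    have h1 : ∫ ω, H (m + 1) ω ∂P ≤ (m + 1 : ℕ) * C := by
      calc ∫ ω, H (m + 1) ω ∂P ≤ ∫ _, ((m + 1 : ℕ) * C : ℝ) ∂P :=
            integral_mono (hHi _) (integrable_const _) fun ω => (abs_le.1 (hHb _ ω)).2
        _ = _ := by simp
    have := hg (2 * (m + 1))
    rw [div_le_iff₀ (by positivity)]
    linarith
  have hbdd : BddAbove (Set.range c) := ⟨C, by rintro _ ⟨m, rfl⟩; exact hcb m⟩
  set β := ⨆ m, c m with hβ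
  have hβ0 : 0 < β := by
    obtain ⟨m, rfl⟩ := Nat.exists_eq_succ_of_ne_zero hN.ne'
    refine lt_of_lt_of_le ?_ (le_ciSup hbdd m)
    exact div_pos (sub_pos.2 hpos) (by positivity)
  -- almost surely, the negative part of `H n / n - β` vanishes in the limit
  have hlow : ∀ᵐ ω ∂P, Tendsto (fun n : ℕ => max (β - H n ω / n) 0) atTop (𝓝 0) := by
    have hall := ae_all_iff.2 fun m : ℕ => ae_eventually_lt_localScore_div (K := K) (g := g)
      hZ hm hlaw hC hKC hg hmono m.succ_pos
    filter_upwards [hall] with ω hω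
    rw [tendsto_order]
    refine ⟨fun a ha => Eventually.of_forall fun n => ha.trans_le (le_max_right _ _),
      fun a ha => ?_⟩
    obtain ⟨m, hm'⟩ := exists_lt_of_lt_ciSup (show β - a < ⨆ m, c m by linarith)
    filter_upwards [hω m (β - a) hm'] with n hn
    have hn' : β - a < H n ω / n := hn
    exact max_lt (by linarith) ha
  have hHm : ∀ n, Measurable fun ω => H n ω / n := fun n =>
    (measurable_comp_randomWord hm (localScore K g)).div_const _
  have hneg : Tendsto (fun n : ℕ => ∫ ω, max (β - H n ω / n) 0 ∂P) atTop (𝓝 0) := by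
    have := tendsto_integral_of_dominated_convergence (μ := P) (fun _ => β + C)
      (F := fun (n : ℕ) ω => max (β - H n ω / n) 0) (f := fun _ => 0)
      (fun n => ((measurable_const.sub (hHm n)).max measurable_const).aestronglyMeasurable)
      (integrable_const _) (fun n => ae_of_all _ fun ω => ?_) hlow
    · simpa using this
    · rw [Real.norm_of_nonneg (le_max_right _ _)]
      have := (abs_le.1 (hZb n ω)).1
      exact max_le (by linarith) (by linarith)
  have hgap : Tendsto (fun n : ℕ => 4 * (g (2 * n) / (2 * n : ℕ))) atTop (𝓝 0) := by
    simpa using (hsub.comp (tendsto_id.const_mul_atTop' (two_pos : 0 < 2))).const_mul 4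
  have hZi : ∀ n : ℕ, Integrable (fun ω => H n ω / n) P := fun n => (hHi n).div_const _
  have hnegi : ∀ n : ℕ, Integrable (fun ω => max (β - H n ω / n) 0) P := fun n =>
    ((integrable_const β).sub (hZi n)).pos_part
  -- the mean of `H n / n` is at most `β + o(1)`, hence the positive part vanishes in mean too
  have hL1 : Tendsto (fun n : ℕ => ∫ ω, |H n ω / n - β| ∂P) atTop (𝓝 0) := by
    have hlim : Tendsto (fun n : ℕ => 4 * (g (2 * n) / (2 * n : ℕ))
        + 2 * ∫ ω, max (β - H n ω / n) 0 ∂P) atTop (𝓝 0) := by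
      simpa using hgap.add (hneg.const_mul 2)
    refine squeeze_zero' (Eventually.of_forall fun n => integral_nonneg fun ω => abs_nonneg _)
      ?_ hlim
    filter_upwards [eventually_gt_atTop 0] with n hn
    have e : ∀ ω, |H n ω / n - β| = (H n ω / n - β) + 2 * max (β - H n ω / n) 0 := by
      intro ω
      rcases le_total (β - H n ω / n) 0 with h | h
      · rw [max_eq_right h, abs_of_nonneg (by linarith)]; ring
      · rw [max_eq_left h, abs_of_nonpos (by linarith)]; ring
    simp only [e]
    have hdiff : Integrable (fun ω => H n ω / n - β) P := (hZi n).sub (integrable_const β)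
    rw [integral_add hdiff ((hnegi n).const_mul 2),
      integral_const_mul, integral_sub (hZi n) (integrable_const β), integral_div]
    simp only [integral_const, probReal_univ, one_smul]
    obtain ⟨m, rfl⟩ := Nat.exists_eq_succ_of_ne_zero hn.ne'
    have h1 : c m ≤ β := le_ciSup hbdd m
    have h2 : c m = (∫ ω, H (m + 1) ω ∂P) / (m + 1 : ℕ)
        - 4 * (g (2 * (m + 1)) / (2 * (m + 1) : ℕ)) := by
      simp only [c]
      push_cast
      field_simp
      ring
    simp only [Nat.succ_eq_add_one]
    linarith
  refine ⟨β, hβ0, ?_, ?_⟩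
  · have hlim : Tendsto (fun n : ℕ => 4 * (g n / n) + ∫ ω, |H n ω / n - β| ∂P) atTop (𝓝 0) := by
      simpa using (hsub.const_mul 4).add hL1
    rw [tendsto_iff_dist_tendsto_zero]
    refine squeeze_zero (fun n => dist_nonneg) (fun n => ?_) hlim
    rw [Real.dist_eq]
    have e : (∫ ω, G n ω / n ∂P) - β = ∫ ω, (G n ω / n - β) ∂P := by
      rw [integral_sub ((hGi n).div_const _) (integrable_const β)]
      simp
    change |(∫ ω, G n ω / n ∂P) - β| ≤ _
    rw [e]
    refine abs_integral_le_integral_abs.trans ?_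
    have hdom : ∀ ω, |G n ω / n - β| ≤ 4 * (g n / n) + |H n ω / n - β| := by
      intro ω
      have h1 : |G n ω / n - H n ω / n| ≤ 4 * (g n / n) := by
        rw [← sub_div, abs_div, Nat.abs_cast, mul_div_assoc']
        gcongr
        exact abs_globalScore_sub_localScore_le hC hKC hg hmono _ _
      calc |G n ω / n - β| ≤ |G n ω / n - H n ω / n| + |H n ω / n - β| := abs_sub_le _ _ _
        _ ≤ _ := by gcongr
    have hZβ : Integrable (fun ω => |H n ω / n - β|) P := ((hZi n).sub (integrable_const β)).abs
    calc ∫ ω, |G n ω / n - β| ∂P ≤ ∫ ω, (4 * (g n / n) + |H n ω / n - β|) ∂P :=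
          integral_mono (((hGi n).div_const _).sub (integrable_const β)).abs
            ((integrable_const _).add hZβ) hdom
      _ = _ := by
          rw [integral_add (integrable_const _) hZβ]
          simp
  · refine tendstoInMeasure_of_tendsto_eLpNorm one_ne_zero
      (fun n => (hHm n).aestronglyMeasurable) aestronglyMeasurable_const ?_
    have h1 : ∀ n : ℕ, eLpNorm ((fun ω => H n ω / n) - fun _ => β) 1 P =
        ENNReal.ofReal (∫ ω, |H n ω / n - β| ∂P) := by
      intro n
      rw [eLpNorm_one_eq_lintegral_enorm, ← ofReal_integral_norm_eq_lintegral_enorm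
        ((hZi n).sub (integrable_const β))]
      rfl
    have h2 := (ENNReal.continuous_ofReal.tendsto 0).comp hL1
    rw [ENNReal.ofReal_zero] at h2
    exact h2.congr fun n => (h1 n).symm

end Linear

/-! ### The two domains -/

section Domains

variable {Ω A : Type*} [MeasurableSpace Ω] [Fintype A] [MeasurableSpace A]
  [MeasurableSingletonClass A] {P : Measure Ω} [IsProbabilityMeasure P] {μ : Measure A}
  [IsProbabilityMeasure μ] {Z : ℕ ⊕ ℕ → Ω → A} {K : A → A → ℝ} {γ : ℕ → ℝ} {θ C : ℝ}

/-- Windows in which gluing is profitable: the mean ungapped score in a window of length `N` is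
about `(2 / θ) log N`, while the gaps cost at most `(2 / θ₁) log N` plus a constant. -/
lemma exists_window_gap_lt_mean (hZ : iIndepFun Z P) (hm : ∀ i, Measurable (Z i))
    (hlaw : ∀ i, P.map (Z i) = μ) (hμ : ∀ a, 0 < μ.real {a}) (hK : ∀ a b, K a b = K b a)
    (hKpos : ∃ a b, 0 < K a b) (hθ : 0 < θ) (hroot : ∑ a, ∑ b, tiltedWeight μ K θ a b = 1)
    (hC : 0 ≤ C) (hKC : ∀ a b, |K a b| ≤ C) (hγ : IsGapExtension γ) {Δ : ℝ} (hΔ : 0 ≤ Δ)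
    {θ₁ : ℝ} (hθ₁ : θ < θ₁) (hfreq : ∃ᶠ k : ℕ in atTop, γ k ≤ Real.log k / θ₁) :
    ∃ N > 0, 2 * gapPenalty Δ γ (2 * N) <
      ∫ ω, localScore K (gapPenalty Δ γ) (randomWord (fun i => Z (.inl i)) N ω)
        (randomWord (fun i => Z (.inr i)) N ω) ∂P := by
  have hθ₁0 : 0 < θ₁ := hθ.trans hθ₁
  have hθθ : 2 / θ₁ < 2 / θ := div_lt_div_of_pos_left two_pos hθ hθ₁
  obtain ⟨s, hs1, hs2⟩ := exists_between hθθ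
  obtain ⟨s', hs1', hs2'⟩ := exists_between hs1
  have hs'0 : 0 < s' := lt_trans (by positivity) hs1'
  have hs0 : 0 < s := hs'0.trans hs2'
  set H : ℕ → Ω → ℝ := fun n ω => localScore K (gapPenalty Δ γ)
    (randomWord (fun i => Z (.inl i)) n ω) (randomWord (fun i => Z (.inr i)) n ω) with hH
  have hbad := tendsto_measureReal_localScore_lt_mul_log (g := gapPenalty Δ γ) hZ hm hlaw hμ hK
    hKpos hθ hroot hC hKC gapPenalty_zero (gapPenalty_nonneg hγ hΔ) hs0 hs2
  have hη : 0 < (s - s') / s := div_pos (sub_pos.2 hs2') hs0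
  have hlog : Tendsto (fun n : ℕ => Real.log n) atTop atTop :=
    Real.tendsto_log_atTop.comp tendsto_natCast_atTop_atTop
  have hbig := (hlog.const_mul_atTop (sub_pos.2 hs1')).eventually_gt_atTop
    (2 * Δ + C + 2 / θ₁ * Real.log 3)
  have hev : ∀ᶠ N : ℕ in atTop, 0 < N ∧
      2 * Δ + 2 / θ₁ * Real.log (3 * N) < ∫ ω, H N ω ∂P := by
    filter_upwards [hbad.eventually (gt_mem_nhds hη), hbad.eventually (gt_mem_nhds one_pos),
      hbig, eventually_gt_atTop 0, hlog.eventually_ge_atTop 0] with N h1 h1' h2 hN hl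
    refine ⟨hN, ?_⟩
    have hN' : (0 : ℝ) < N := by exact_mod_cast hN
    set B : Set Ω := {ω | H N ω < s * Real.log N} with hB
    have hBm : MeasurableSet B := measurableSet_lt
      (measurable_comp_randomWord hm (localScore K (gapPenalty Δ γ))) measurable_const
    have hpt : ∀ ω, s * Real.log N - B.indicator (fun _ => s * Real.log N + C) ω ≤ H N ω := by
      intro ω
      by_cases hω : ω ∈ B
      · rw [Set.indicator_of_mem hω]
        have := neg_le_localScore hC hKC (gapPenalty_nonneg hγ hΔ) hN
          (randomWord (fun i => Z (.inl i)) N ω) (randomWord (fun i => Z (.inr i)) N ω)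
        simp only [hH]
        linarith
      · rw [Set.indicator_of_notMem hω]
        have : ¬ H N ω < s * Real.log N := hω
        linarith
    have hind : Integrable (B.indicator fun _ => s * Real.log N + C) P :=
      (integrable_const _).indicator hBm
    have hint := integral_mono ((integrable_const _).sub hind)
      (integrable_comp_randomWord hm (localScore K (gapPenalty Δ γ))) hpt
    have hval : ∫ ω, (s * Real.log N - B.indicator (fun _ => s * Real.log N + C) ω) ∂P =
        s * Real.log N - P.real B * (s * Real.log N + C) := by
      rw [integral_sub (integrable_const _) hind, integral_indicator_const _ hBm]
      simp
    have hint' : s * Real.log N - P.real B * (s * Real.log N + C) ≤ ∫ ω, H N ω ∂P := by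
      rw [← hval]; exact hint
    have h3 : P.real B * (s * Real.log N) ≤ (s - s') * Real.log N := by
      calc P.real B * (s * Real.log N) ≤ (s - s') / s * (s * Real.log N) :=
            mul_le_mul_of_nonneg_right h1.le (by positivity)
        _ = _ := by field_simp
    have h4 : P.real B * C ≤ C := mul_le_of_le_one_left hC h1'.le
    rw [Real.log_mul (by norm_num) hN'.ne']
    linarith
  have hhalf : Tendsto (fun k : ℕ => k / 2) atTop atTop :=
    Nat.tendsto_div_const_atTop two_ne_zero
  obtain ⟨k, hk, ⟨hN, hlt⟩, hk2⟩ := (hfreq.and_eventually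
    ((hhalf.eventually hev).and (eventually_ge_atTop 2))).exists
  refine ⟨k / 2, hN, lt_of_le_of_lt ?_ hlt⟩
  have h1 : gapPenalty Δ γ (2 * (k / 2)) ≤ gapPenalty Δ γ k :=
    monotone_gapPenalty hγ hΔ (Nat.mul_div_le k 2)
  obtain ⟨m, rfl⟩ := Nat.exists_eq_add_of_le' hk2
  rw [gapPenalty_succ] at h1
  have h2 : Real.log (m + 2 : ℕ) ≤ Real.log (3 * ((m + 2) / 2 : ℕ)) := by
    refine Real.log_le_log (by positivity) ?_
    have : m + 2 ≤ 3 * ((m + 2) / 2) := by omega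
    exact_mod_cast this
  have h3 : γ (m + 2) ≤ Real.log (3 * ((m + 2) / 2 : ℕ)) / θ₁ := hk.trans (by gcongr)
  calc 2 * gapPenalty Δ γ (2 * ((m + 2) / 2)) ≤ 2 * (Δ + γ (m + 2)) := by gcongr
    _ ≤ 2 * (Δ + Real.log (3 * ((m + 2) / 2 : ℕ)) / θ₁) := by gcongr
    _ = _ := by ring

lemma inLinearDomain_of_not_summable (hZ : iIndepFun Z P) (hm : ∀ i, Measurable (Z i))
    (hlaw : ∀ i, P.map (Z i) = μ) (hμ : ∀ a, 0 < μ.real {a}) (hK : ∀ a b, K a b = K b a)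
    (hKpos : ∃ a b, 0 < K a b) (hθ : 0 < θ) (hroot : ∑ a, ∑ b, tiltedWeight μ K θ a b = 1)
    (hC : 0 ≤ C) (hKC : ∀ a b, |K a b| ≤ C) (hγ : IsGapExtension γ) {θ' : ℝ} (hθ' : θ < θ')
    (hsum : ¬ Summable fun k : ℕ => Real.exp (-θ' * γ (k + 1))) {Δ : ℝ} (hΔ : 0 ≤ Δ) :
    InLinearDomain P (fun i => Z (.inl i)) (fun i => Z (.inr i)) K (gapPenalty Δ γ) := by
  obtain ⟨θ₁, h1, h2⟩ := exists_between hθ'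
  have hfreq := frequently_le_log_div (hθ.trans h1) h2 hsum
  obtain ⟨N, hN, hpos⟩ := exists_window_gap_lt_mean hZ hm hlaw hμ hK hKpos hθ hroot hC hKC hγ hΔ
    h1 hfreq
  exact inLinearDomain_of_window hZ hm hlaw hC hKC (gapPenalty_nonneg hγ hΔ)
    (monotone_gapPenalty hγ hΔ) (tendsto_gapPenalty_div hγ hΔ hfreq) hN hpos

lemma inLogarithmicDomain_of_summable (hZ : iIndepFun Z P) (hm : ∀ i, Measurable (Z i))
    (hlaw : ∀ i, P.map (Z i) = μ) (hμ : ∀ a, 0 < μ.real {a}) (hK : ∀ a b, K a b = K b a)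
    (hKpos : ∃ a b, 0 < K a b) (hθ : 0 < θ) (hroot : ∑ a, ∑ b, tiltedWeight μ K θ a b = 1)
    (hC : 0 ≤ C) (hKC : ∀ a b, |K a b| ≤ C) (hγ : IsGapExtension γ) {θ' : ℝ} (hθ' : θ' < θ)
    (hsum : Summable fun k : ℕ => Real.exp (-θ' * γ (k + 1))) :
    ∃ Δ₀ : ℝ, ∀ Δ ≥ Δ₀,
      InLogarithmicDomain P (fun i => Z (.inl i)) (fun i => Z (.inr i)) K (gapPenalty Δ γ) := by
  -- for `θ' ≤ 0` the terms of the series are at least `1`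
  have h0 : 0 < θ' := by
    by_contra hneg
    obtain ⟨k, hk⟩ := (hsum.tendsto_atTop_zero.eventually (gt_mem_nhds one_pos)).exists
    have : 0 ≤ -θ' * γ (k + 1) := mul_nonneg (by linarith) (hγ.nonneg k)
    linarith [Real.one_le_exp this]
  set φ := ∑ a, ∑ b, μ.real {a} * μ.real {b} * Real.exp (θ' * K a b) with hφ
  have hφ1 : φ < 1 := expMoment_lt_one hμ hKpos hroot h0 hθ'
  set S := ∑' k : ℕ, Real.exp (-θ' * γ (k + 1)) with hS
  have hlim : Tendsto (fun Δ : ℝ => φ * (1 + Real.exp (-(θ' * Δ)) * S) ^ 2) atTop (𝓝 φ) := by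
    have h1 : Tendsto (fun Δ : ℝ => Real.exp (-(θ' * Δ))) atTop (𝓝 0) :=
      Real.tendsto_exp_neg_atTop_nhds_zero.comp (tendsto_id.const_mul_atTop h0)
    simpa using (((h1.mul_const S).const_add 1).pow 2).const_mul φ
  obtain ⟨Δ₁, hΔ₁⟩ := eventually_atTop.1 (hlim.eventually (gt_mem_nhds hφ1))
  refine ⟨max Δ₁ 0, fun Δ hΔ => ?_⟩
  have hΔ0 : 0 ≤ Δ := (le_max_right _ _).trans hΔ
  have hD : ∀ n, ∑ k ∈ Finset.range n, Real.exp (-θ' * gapPenalty Δ γ k) ≤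
      1 + Real.exp (-(θ' * Δ)) * S := by
    intro n
    calc ∑ k ∈ Finset.range n, Real.exp (-θ' * gapPenalty Δ γ k)
        ≤ ∑ k ∈ Finset.range (n + 1), Real.exp (-θ' * gapPenalty Δ γ k) :=
          Finset.sum_le_sum_of_subset_of_nonneg (Finset.range_mono n.le_succ)
            fun k _ _ => (Real.exp_pos _).le
      _ = 1 + Real.exp (-(θ' * Δ)) * ∑ k ∈ Finset.range n, Real.exp (-θ' * γ (k + 1)) := by
          rw [Finset.sum_range_succ', gapPenalty_zero, mul_zero, Real.exp_zero, add_comm,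
            Finset.mul_sum]
          congr 1
          refine Finset.sum_congr rfl fun k _ => ?_
          rw [gapPenalty_succ, ← Real.exp_add]
          congr 1
          ring
      _ ≤ _ := by
          gcongr
          exact hsum.sum_le_tsum _ fun k _ => (Real.exp_pos _).le
  have hup := tendsto_measureReal_mul_log_lt_localScore (K := K) (g := gapPenalty Δ γ) hZ hm hlaw
    h0 hD hφ1.le (hΔ₁ Δ ((le_max_left _ _).trans hΔ))
  have hlow := tendsto_measureReal_localScore_lt_mul_log (g := gapPenalty Δ γ) (s := 1 / θ) hZ hm
    hlaw hμ hK hKpos hθ hroot hC hKC gapPenalty_zero (gapPenalty_nonneg hγ hΔ0) (by positivity)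
    (by gcongr; norm_num)
  have hθθ' : 1 / θ < 3 / θ' := by
    rw [div_lt_div_iff₀ hθ h0]; linarith
  have hhalf : 1 / (2 * θ) < 1 / θ := one_div_lt_one_div_of_lt hθ (by linarith)
  refine ⟨1 / (2 * θ), 3 / θ' + 1, by positivity, by linarith, ?_⟩
  set H : ℕ → Ω → ℝ := fun n ω => localScore K (gapPenalty Δ γ)
    (randomWord (fun i => Z (.inl i)) n ω) (randomWord (fun i => Z (.inr i)) n ω) with hH
  change Tendsto (fun n : ℕ => P {ω | 1 / (2 * θ) < H n ω / Real.log n ∧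
    H n ω / Real.log n < 3 / θ' + 1}) atTop (𝓝 1)
  rw [← ENNReal.tendsto_toReal_iff (fun n => measure_ne_top _ _) ENNReal.one_ne_top]
  have hlim1 : Tendsto (fun n : ℕ => 1 - (P.real {ω | 3 / θ' * Real.log n < H n ω}
      + P.real {ω | H n ω < 1 / θ * Real.log n})) atTop (𝓝 1) := by
    simpa using (hup.add hlow).const_sub 1
  refine tendsto_of_tendsto_of_tendsto_of_le_of_le' hlim1 tendsto_const_nhds ?_
    (Eventually.of_forall fun n => measureReal_le_one (μ := P))
  filter_upwards [eventually_ge_atTop 2] with n hn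
  have hlogn : 0 < Real.log n := Real.log_pos (by exact_mod_cast hn)
  have hcover : (Set.univ : Set Ω) ⊆
      {ω | 1 / (2 * θ) < H n ω / Real.log n ∧ H n ω / Real.log n < 3 / θ' + 1} ∪
        ({ω | 3 / θ' * Real.log n < H n ω} ∪ {ω | H n ω < 1 / θ * Real.log n}) := by
    intro ω _
    by_cases h1 : 3 / θ' * Real.log n < H n ω
    · exact Or.inr (Or.inl h1)
    by_cases h2 : H n ω < 1 / θ * Real.log n
    · exact Or.inr (Or.inr h2)
    refine Or.inl ⟨hhalf.trans_le ((le_div_iff₀ hlogn).2 (not_lt.1 h2)), ?_⟩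
    exact lt_of_le_of_lt ((div_le_iff₀ hlogn).2 (not_lt.1 h1)) (lt_add_one _)
  have h1 : (1 : ℝ) ≤ P.real {ω | 1 / (2 * θ) < H n ω / Real.log n ∧
      H n ω / Real.log n < 3 / θ' + 1} + (P.real {ω | 3 / θ' * Real.log n < H n ω}
        + P.real {ω | H n ω < 1 / θ * Real.log n}) := by
    calc (1 : ℝ) = P.real Set.univ := by simp
      _ ≤ _ := measureReal_mono hcover
      _ ≤ _ := (measureReal_union_le _ _).trans (by gcongr; exact measureReal_union_le _ _)
  rw [← measureReal_def]
  linarith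

end Domains

theorem theorem1 {A Ω : Type*} [Finite A] [MeasurableSpace A] [MeasurableSingletonClass A]
    [MeasurableSpace Ω] (P : Measure Ω) [IsProbabilityMeasure P]
    (μ : Measure A) [IsProbabilityMeasure μ] (hμ : ∀ a, 0 < μ {a})
    (X Y : ℕ → Ω → A)
    (hXm : ∀ i, Measurable (X i)) (hYm : ∀ i, Measurable (Y i))
    (hXY : iIndepFun (Sum.elim X Y) P)
    (hX : ∀ i, P.map (X i) = μ) (hY : ∀ i, P.map (Y i) = μ)
    (K : A → A → ℝ) (hK : ∀ a b, K a b = K b a)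
    (hKneg : ∫ ω, K (X 0 ω) (Y 0 ω) ∂P < 0) (hKpos : ∃ a b, 0 < K a b)
    (θ : ℝ) (hθ : 0 < θ) (hroot : ∫ ω, Real.exp (θ * K (X 0 ω) (Y 0 ω)) ∂P = 1) :
    (∀ γ : ℕ → ℝ, IsGapExtension γ →
      (∀ θ' < θ, Summable (fun k : ℕ => Real.exp (-θ' * γ (k + 1))) →
        ∃ Δ₀ : ℝ, ∀ Δ ≥ Δ₀, InLogarithmicDomain P X Y K (gapPenalty Δ γ)) ∧
      (∀ θ' > θ, ¬ Summable (fun k : ℕ => Real.exp (-θ' * γ (k + 1))) →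
        ∀ Δ : ℝ, 0 ≤ Δ → InLinearDomain P X Y K (gapPenalty Δ γ))) ∧
    (∀ δ : ℝ, 0 < δ →
      (δ > 1 / θ → ∃ Δ₀ : ℝ, ∀ Δ ≥ Δ₀,
        InLogarithmicDomain P X Y K (gapPenalty Δ (fun k => δ * Real.log k))) ∧
      (δ < 1 / θ → ∀ Δ : ℝ, 0 ≤ Δ →
        InLinearDomain P X Y K (gapPenalty Δ (fun k => δ * Real.log k)))) := by
  have := Fintype.ofFinite A
  have hm : ∀ i, Measurable (Sum.elim X Y i) := by
    rintro (i | i)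
    · exact hXm i
    · exact hYm i
  have hlaw : ∀ i, P.map (Sum.elim X Y i) = μ := by
    rintro (i | i)
    · exact hX i
    · exact hY i
  have hμ' : ∀ a, 0 < μ.real {a} := fun a => ENNReal.toReal_pos (hμ a).ne' (measure_ne_top _ _)
  have hroot' : ∑ a, ∑ b, tiltedWeight μ K θ a b = 1 := by
    rw [← hroot]
    have h := integral_prod_matches (u := 1) (I := fun _ => 0) (J := fun _ => 0) hXY hm hlaw
      (Function.injective_of_subsingleton _) (Function.injective_of_subsingleton _)
      (fun a b => Real.exp (θ * K a b))
    simp only [Finset.univ_unique, Finset.prod_singleton, pow_one] at h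
    rw [integral_prod_eq_sum (fun a b => Real.exp (θ * K a b))] at h
    exact h.symm
  obtain ⟨C, hC, hKC⟩ : ∃ C, 0 ≤ C ∧ ∀ a b, |K a b| ≤ C :=
    ⟨∑ a, ∑ b, |K a b|, Finset.sum_nonneg fun a _ => Finset.sum_nonneg fun b _ => abs_nonneg _,
      fun a b => (Finset.single_le_sum (f := fun b => |K a b|) (fun b _ => abs_nonneg _)
        (Finset.mem_univ b)).trans (Finset.single_le_sum (f := fun a => ∑ b, |K a b|)
          (fun a _ => Finset.sum_nonneg fun b _ => abs_nonneg _) (Finset.mem_univ a))⟩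
  have hlogdom : ∀ γ : ℕ → ℝ, IsGapExtension γ → ∀ θ' < θ,
      Summable (fun k : ℕ => Real.exp (-θ' * γ (k + 1))) →
      ∃ Δ₀ : ℝ, ∀ Δ ≥ Δ₀, InLogarithmicDomain P X Y K (gapPenalty Δ γ) :=
    fun γ hγ θ' hθ' hsum => by
      simpa only [Sum.elim_inl, Sum.elim_inr] using inLogarithmicDomain_of_summable hXY hm hlaw
        hμ' hK hKpos hθ hroot' hC hKC hγ hθ' hsum
  have hlindom : ∀ γ : ℕ → ℝ, IsGapExtension γ → ∀ θ' > θ,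
      ¬ Summable (fun k : ℕ => Real.exp (-θ' * γ (k + 1))) →
      ∀ Δ : ℝ, 0 ≤ Δ → InLinearDomain P X Y K (gapPenalty Δ γ) :=
    fun γ hγ θ' hθ' hsum Δ hΔ => by
      simpa only [Sum.elim_inl, Sum.elim_inr] using inLinearDomain_of_not_summable hXY hm hlaw
        hμ' hK hKpos hθ hroot' hC hKC hγ hθ' hsum hΔ
  refine ⟨fun γ hγ => ⟨hlogdom γ hγ, hlindom γ hγ⟩, fun δ hδ => ⟨fun h => ?_, fun h => ?_⟩⟩
  · obtain ⟨θ', h1, h2⟩ := exists_between (show 1 / δ < θ from (one_div_lt hδ hθ).2 h)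
    exact hlogdom _ (isGapExtension_mul_log hδ) θ' h2
      (summable_exp_mul_log_iff.2 ((div_lt_iff₀ hδ).1 h1))
  · refine hlindom _ (isGapExtension_mul_log hδ) (1 / δ) ((lt_one_div hδ hθ).1 h) ?_
    rw [summable_exp_mul_log_iff, one_div, inv_mul_cancel₀ hδ.ne']
    exact lt_irrefl 1
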